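/- Let $n\ge 2$ agents with equal entitlements share a finite set $\mathcal M$ of indivisible items, and let each agent $i$ have a valuation $v_i:2^{\mathcal M}\to\mathbb R$ that is monotone ($v_i(S)\le v_i(T)$ whenever $S\subseteq T\subseteq\mathcal M$) and subadditive ($v_i(S\cup T)\le v_i(S)+v_i(T)$ for all $S,T\subseteq\mathcal M$). Let $$\mathrm{MMS}_i=\max_{(B_1,\dots,B_n)}\ \min_{1\le j\le n} v_i(B_j)$$ be the maximin share of agent $i$, where the maximum is over all partitions of $\mathcal M$ into $n$ (possibly empty) bundles. Then there is an allocation, that is, a partition $(A_1,\dots,A_n)$ of $\mathcal M$ into $n$ (possibly empty) bundles, such that for every agent $i$ $$v_i(A_i)\ \ge\ \frac{1}{14\log_2 n}\,\mathrm{MMS}_i .$$ -/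

import Mathlib

namespace FairAllocation

/-- A set function `v` on bundles of items is subadditive if `v (S ∪ T) ≤ v S + v T` for all
bundles `S`, `T` (not necessarily disjoint). -/
def IsSubadditive {M : Type*} [DecidableEq M] (v : Finset M → ℝ) : Prop :=
  ∀ S T : Finset M, v (S ∪ T) ≤ v S + v T

/-- The `j`-th bundle of the assignment `a` of items to the labels `0, …, n - 1`. Assignments
`a : M → Fin n` are exactly the ordered partitions of the items into `n` (possibly empty)
bundles. -/
def bundle {M : Type*} [Fintype M] {n : ℕ} (a : M → Fin n) (j : Fin n) : Finset M :=
  Finset.univ.filter fun e => a e = j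

/-- The maximin share of an agent with valuation `v` among `n` agents: the maximum, over all
partitions of the items into `n` bundles, of the value of the least valuable bundle.
For `n ≥ 1` both the supremum and the infimum range over finite nonempty types,
so they are a maximum and a minimum. -/
noncomputable def mms {M : Type*} [Fintype M] (n : ℕ) (v : Finset M → ℝ) : ℝ :=
  ⨆ a : M → Fin n, ⨅ j : Fin n, v (bundle a j)

end FairAllocation

/-!
Normalise all maximin shares to `1` and let `t = 1 / (14 log₂ n)`. An agent who values a single
item at `t` is served by that item, which spoils at most one bundle of each other agent; so all
items may be assumed to be worth less than `t` to everybody. Let `n` now denote the number of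
remaining agents. If `n ≤ 36`, then bag filling works (`exists_allocation_of_total_value`): a
minimal set worth `t` to somebody costs the others less than `2 t` each, and `(2 n - 1) t ≤ 1`.

For larger `n` the agents are served in `R` rounds, `R` being of order at most `log n`. The items
are coloured at random with `R` colours, one for each round. By subadditivity a colour class
contains on average at least `1 / R` of the value of a bundle, and since the bundles of an agent
are coloured independently, a Chernoff bound produces one colouring for which every agent finds at
least half of the expected value `n / R` in every colour class (`exists_balanced_coloring`). As
items are small, this value splits into `c n` disjoint pieces worth `2 t` each, for a constant `c`
depending on `n`.

The heart of the proof is that a single round serves most agents: if each of `k` agents has `N > k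
m` disjoint pieces worth `2 t`, the items can be assigned so that at most `k / (m + 1)` agents get
less than `t` (`exists_assignment_few_unserved`). Consider a simultaneous first-price auction in
which an agent gains a large reward for winning a set worth `t`, and a coarse correlated
equilibrium of it, which exists by separation of convex sets. An agent may deviate by choosing a
random piece and outbidding on it the maximum of `m` independent samples ("ghosts") of the highest
rival bids. Take these samples together with the actual rival bids, `m + 1` profiles in all. At
most one of them can defeat all others on so much of the piece that the rest is worth less than
`t`, because the complements of what two different profiles win cover the piece, which is worth `2
t`. By symmetry the deviation fails with probability at most `1 / (m + 1)`. The expected payments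
of all deviations together are at most `k m / N < 1` times the revenue, up to rounding. As no
deviation is profitable, and as payoffs plus revenue add up to the total reward, at least `k m /
(m + 1)` agents are served on average, hence for some bid profile.

After such a round the number of unserved agents drops from `k` to at most `k ^ 2 / (c n)`, so
that after `s` rounds at most `n / c ^ (2 ^ s - 1)` agents are left
(`exists_allocation_after_rounds`). For suitable `R` and `c` this is less than one agent when `s =
R` (`exists_round_parameters`).
-/

namespace FairAllocation

/-! ### Product distributions on finite types -/

theorem sum_prod_weights {ι α : Type*} [Fintype ι] [DecidableEq ι] [Fintype α]
    (z : ι → α → ℝ) (hz : ∀ i, ∑ a, z i a = 1) :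
    ∑ b : ι → α, ∏ j, z j (b j) = 1 := by
  rw [← Fintype.prod_sum]
  simp [hz]

/-- Resampling one coordinate of a product distribution does not change expectations. -/
theorem sum_prod_weights_resample {ι α : Type*} [Fintype ι] [DecidableEq ι] [Fintype α]
    (z : ι → α → ℝ) (i : ι) (hz : ∑ a, z i a = 1) (φ : (ι → α) → ℝ) :
    ∑ b : ι → α, (∏ j, z j (b j)) * ∑ a, z i a * φ (Function.update b i a)
      = ∑ b : ι → α, (∏ j, z j (b j)) * φ b := by
  -- The involution exchanging coordinate `i` of `b` with the fresh sample `a` preserves weights.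
  let e : (ι → α) × α → (ι → α) × α := fun p => (Function.update p.1 i p.2, p.1 i)
  have he : Function.Involutive e := by
    intro p
    ext <;> simp [e]
  have hw : ∀ p : (ι → α) × α,
      (∏ j, z j ((e p).1 j)) * z i (e p).2 = (∏ j, z j (p.1 j)) * z i p.2 := by
    rintro ⟨b, a⟩
    simp only [e]
    rw [← Finset.mul_prod_erase _ _ (Finset.mem_univ i),
      ← Finset.mul_prod_erase _ (fun j => z j (b j)) (Finset.mem_univ i)]
    have : ∏ j ∈ Finset.univ.erase i, z j (Function.update b i a j)
        = ∏ j ∈ Finset.univ.erase i, z j (b j) :=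
      Finset.prod_congr rfl fun j hj => by
        rw [Function.update_of_ne (Finset.ne_of_mem_erase hj)]
    rw [this, Function.update_self]
    ring
  calc ∑ b : ι → α, (∏ j, z j (b j)) * ∑ a, z i a * φ (Function.update b i a)
      = ∑ p : (ι → α) × α, (∏ j, z j ((e p).1 j)) * z i (e p).2 * φ (e p).1 := by
        rw [Fintype.sum_prod_type]
        refine Finset.sum_congr rfl fun b _ => ?_
        rw [Finset.mul_sum]
        refine Finset.sum_congr rfl fun a _ => ?_
        rw [hw (b, a)]
        simp only [e]
        ring
    _ = ∑ p : (ι → α) × α, (∏ j, z j (p.1 j)) * z i p.2 * φ p.1 :=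
        Equiv.sum_comp he.toPerm
          (fun p : (ι → α) × α => (∏ j, z j (p.1 j)) * z i p.2 * φ p.1)
    _ = ∑ b : ι → α, (∏ j, z j (b j)) * φ b := by
        rw [Fintype.sum_prod_type]
        refine Finset.sum_congr rfl fun b _ => ?_
        calc ∑ a, (∏ j, z j (b j)) * z i a * φ b
            = (∑ a, z i a) * ((∏ j, z j (b j)) * φ b) := by
              rw [Finset.sum_mul]
              exact Finset.sum_congr rfl fun a _ => by ring
          _ = _ := by rw [hz, one_mul]

/-! ### Existence of coarse correlated equilibria -/

/-- A theorem of the alternative for finite zero-sum games: if every nonnegative combination of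
the rows is nonpositive in some column, then some mixture of the columns is nonpositive in every
row. -/
theorem exists_mixture_nonpos {D S : Type*} [Fintype D] [Fintype S] [Nonempty S]
    (A : D → S → ℝ)
    (h : ∀ y : D → ℝ, (∀ d, 0 ≤ y d) → ∃ s, ∑ d, y d * A d s ≤ 0) :
    ∃ σ ∈ stdSimplex ℝ S, ∀ d, ∑ s, σ s * A d s ≤ 0 := by
  classical
  by_contra! hcon
  let L : (S → ℝ) →ₗ[ℝ] (D → ℝ) :=
    { toFun := fun σ d => ∑ s, σ s * A d s
      map_add' := by
        intro x y; ext d; simp [add_mul, Finset.sum_add_distrib]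
      map_smul' := by
        intro c x; ext d; simp [Finset.mul_sum, mul_assoc] }
  have hLc : Continuous L := L.continuous_of_finiteDimensional
  have hconv : Convex ℝ (L '' stdSimplex ℝ S) := (convex_stdSimplex ℝ S).linear_image L
  have hcomp : IsCompact (L '' stdSimplex ℝ S) := (isCompact_stdSimplex ℝ S).image hLc
  have hcl : IsClosed (Set.Iic (0 : D → ℝ)) := isClosed_Iic
  have hdisj : Disjoint (L '' stdSimplex ℝ S) (Set.Iic (0 : D → ℝ)) := by
    rw [Set.disjoint_left]
    rintro _ ⟨σ, hσ, rfl⟩ hle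
    obtain ⟨d, hd⟩ := hcon σ hσ
    exact absurd (hle d) (not_le.mpr hd)
  obtain ⟨f, u, w, hu, huw, hw⟩ :=
    geometric_hahn_banach_compact_closed hconv hcomp (convex_Iic 0) hcl hdisj
  have hw0 : w < 0 := by simpa using hw 0 (by simp)
  have hf : ∀ x : D → ℝ, f x = ∑ d, x d * f (Pi.single d 1) := by
    intro x
    conv_lhs => rw [pi_eq_sum_univ' x]
    simp [map_sum, Pi.single]
  -- The separating functional is nonpositive on the positive orthant because it is bounded below
  -- on the negative one.
  have hneg : ∀ d, 0 ≤ -f (Pi.single d 1) := by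
    intro d
    by_contra! hd
    have hpos : 0 < f (Pi.single d 1) := by linarith
    have := hw ((w / f (Pi.single d 1)) • Pi.single d 1) (by
      intro d'
      have : w / f (Pi.single d 1) ≤ 0 := div_nonpos_of_nonpos_of_nonneg hw0.le hpos.le
      by_cases hdd : d' = d
      · subst hdd; simpa using this
      · simp [hdd])
    rw [map_smul, smul_eq_mul, div_mul_cancel₀ _ hpos.ne'] at this
    exact lt_irrefl _ this
  obtain ⟨s, hs⟩ := h (fun d => -f (Pi.single d 1)) hneg
  have h1 := hu _ ⟨Pi.single s 1, single_mem_stdSimplex ℝ s, rfl⟩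
  have h2 : L (Pi.single s 1) = fun d => A d s := by
    ext d
    simp [L, Pi.single_apply]
  rw [h2, hf] at h1
  have h3 : ∑ d, -f (Pi.single d 1) * A d s = -∑ d, A d s * f (Pi.single d 1) := by
    rw [← Finset.sum_neg_distrib]
    exact Finset.sum_congr rfl fun d _ => by ring
  rw [h3] at hs
  linarith

/-- Every finite game has a coarse correlated equilibrium: a distribution `σ` on action profiles
against which no player gains in expectation by committing to a fixed action. -/
theorem exists_coarse_correlated_equilibrium {ι α : Type*} [Fintype ι] [DecidableEq ι]
    [Fintype α] [Nonempty α] (u : ι → (ι → α) → ℝ) :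
    ∃ σ ∈ stdSimplex ℝ (ι → α), ∀ i a,
      ∑ b, σ b * u i (Function.update b i a) ≤ ∑ b, σ b * u i b := by
  classical
  obtain ⟨σ, hσ, h⟩ := exists_mixture_nonpos
    (fun (d : ι × α) (b : ι → α) => u d.1 (Function.update b d.1 d.2) - u d.1 b) (by
    intro y hy
    -- Against a mixed deviation `y`, the players draw their actions independently from the
    -- normalised rows of `y`; a deviation is then a mere resampling.
    have hz : ∀ i, ∃ z : α → ℝ, (∀ a, 0 ≤ z a) ∧ ∑ a, z a = 1 ∧
        ∀ a, y (i, a) = (∑ a', y (i, a')) * z a := by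
      intro i
      have hY : 0 ≤ ∑ a', y (i, a') := Finset.sum_nonneg fun a _ => hy _
      rcases hY.eq_or_lt with h0 | hpos
      · obtain ⟨a₀⟩ := ‹Nonempty α›
        refine ⟨Pi.single a₀ 1, fun a => (single_mem_stdSimplex ℝ a₀).1 a,
          (single_mem_stdSimplex ℝ a₀).2, fun a => ?_⟩
        rw [← h0, zero_mul]
        exact (Finset.sum_eq_zero_iff_of_nonneg fun a _ => hy _).mp h0.symm a (Finset.mem_univ a)
      · refine ⟨fun a => y (i, a) / ∑ a', y (i, a'), fun a => div_nonneg (hy _) hY, ?_, ?_⟩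
        · rw [← Finset.sum_div, div_self hpos.ne']
        · intro a
          field_simp
    choose z hz0 hz1 hzy using hz
    by_contra! hcon
    have hw0 : ∀ b : ι → α, 0 ≤ ∏ j, z j (b j) := fun b => Finset.prod_nonneg fun j _ => hz0 j _
    have hsum := sum_prod_weights z hz1
    have hzero : ∑ b : ι → α, (∏ j, z j (b j)) *
        ∑ d : ι × α, y d * (u d.1 (Function.update b d.1 d.2) - u d.1 b) = 0 := by
      have : ∀ i, ∑ b : ι → α, (∏ j, z j (b j)) *
          ∑ a, y (i, a) * (u i (Function.update b i a) - u i b) = 0 := by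
        intro i
        have hr := sum_prod_weights_resample z i (hz1 i) (u i)
        calc ∑ b : ι → α, (∏ j, z j (b j)) *
              ∑ a, y (i, a) * (u i (Function.update b i a) - u i b)
            = (∑ a', y (i, a')) * (∑ b : ι → α, (∏ j, z j (b j)) *
                ∑ a, z i a * u i (Function.update b i a)
                - ∑ b : ι → α, (∏ j, z j (b j)) * u i b) := by
              rw [← Finset.sum_sub_distrib, Finset.mul_sum]
              refine Finset.sum_congr rfl fun b _ => ?_
              have : ∑ a, y (i, a) * (u i (Function.update b i a) - u i b)
                  = (∑ a', y (i, a')) * (∑ a, z i a * u i (Function.update b i a) - u i b) := by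
                calc ∑ a, y (i, a) * (u i (Function.update b i a) - u i b)
                    = ∑ a, (∑ a', y (i, a')) * (z i a * u i (Function.update b i a)
                        - z i a * u i b) :=
                      Finset.sum_congr rfl fun a _ => by
                        conv_lhs => rw [hzy i a]
                        ring
                  _ = _ := by
                      rw [← Finset.mul_sum, Finset.sum_sub_distrib, ← Finset.sum_mul, hz1 i,
                        one_mul]
              rw [this]
              ring
          _ = 0 := by rw [hr, sub_self, mul_zero]
      simp_rw [Fintype.sum_prod_type, Finset.mul_sum (s := (Finset.univ : Finset ι))]
      rw [Finset.sum_comm]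
      exact Finset.sum_eq_zero fun i _ => this i
    have hnn := (Finset.sum_eq_zero_iff_of_nonneg fun b _ =>
      mul_nonneg (hw0 b) (hcon b).le).mp hzero
    have : ∑ b : ι → α, ∏ j, z j (b j) = 0 := Finset.sum_eq_zero fun b hb =>
      (mul_eq_zero.mp (hnn b hb)).resolve_right (hcon b).ne'
    rw [hsum] at this
    exact one_ne_zero this)
  refine ⟨σ, hσ, fun i a => ?_⟩
  have := h (i, a)
  simp only [mul_sub, Finset.sum_sub_distrib] at this
  linarith

/-! ### Simultaneous first-price auctions -/

section Auction

set_option linter.unusedSectionVars false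

variable {ι M : Type*} [Fintype ι] [DecidableEq ι] [Fintype M] {K : ℕ}

/-- The winner of item `e` under the bid profile `b`: some highest bidder, ties being broken by an
arbitrary function of the profile. -/
noncomputable def winner [Nonempty ι] (b : ι → M → Fin (K + 1)) (e : M) : ι :=
  (Finite.exists_max fun i => b i e).choose

theorem le_winner [Nonempty ι] (b : ι → M → Fin (K + 1)) (e : M) (i : ι) :
    b i e ≤ b (winner b e) e :=
  (Finite.exists_max fun i => b i e).choose_spec i

/-- The items won by agent `i`. -/
noncomputable def won [Nonempty ι] (b : ι → M → Fin (K + 1)) (i : ι) : Finset M :=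
  Finset.univ.filter fun e => winner b e = i

/-- The highest bid on `e` among the agents other than `i`. -/
def rivalPrice (b : ι → M → Fin (K + 1)) (i : ι) (e : M) : ℕ :=
  (Finset.univ.erase i).sup fun j => (b j e : ℕ)

/-- The total payment collected when every item is sold at its winning bid. -/
noncomputable def revenue [Nonempty ι] (b : ι → M → Fin (K + 1)) : ℝ :=
  ∑ e, ((b (winner b e) e : ℕ) : ℝ)

/-- The payoff of agent `i`: `lam` if the items won are worth at least `t` to it, minus its bids on
the items it won. -/
noncomputable def payoff [Nonempty ι] (v : ι → Finset M → ℝ) (t lam : ℝ) (i : ι)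
    (b : ι → M → Fin (K + 1)) : ℝ :=
  lam * (if t ≤ v i (won b i) then 1 else 0) - ∑ e ∈ won b i, ((b i e : ℕ) : ℝ)

theorem rivalPrice_update (b : ι → M → Fin (K + 1)) (i : ι) (d : M → Fin (K + 1)) :
    rivalPrice (Function.update b i d) i = rivalPrice b i := by
  ext e
  refine Finset.sup_congr rfl fun j hj => ?_
  rw [Function.update_of_ne (Finset.ne_of_mem_erase hj)]

theorem rivalPrice_le_winner [Nonempty ι] (b : ι → M → Fin (K + 1)) (i : ι) (e : M) :
    rivalPrice b i e ≤ (b (winner b e) e : ℕ) :=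
  Finset.sup_le fun j _ => le_winner b e j

theorem rivalPrice_le (b : ι → M → Fin (K + 1)) (i : ι) (e : M) : rivalPrice b i e ≤ K :=
  Finset.sup_le fun j _ => Nat.le_of_lt_succ (b j e).2

theorem winner_eq_of_rivalPrice_lt [Nonempty ι] (b : ι → M → Fin (K + 1)) (i : ι) (e : M)
    (h : rivalPrice b i e < (b i e : ℕ)) : winner b e = i := by
  by_contra hne
  have h1 : (b (winner b e) e : ℕ) ≤ rivalPrice b i e :=
    Finset.le_sup (f := fun j => (b j e : ℕ)) (Finset.mem_erase.mpr ⟨hne, Finset.mem_univ _⟩)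
  have h2 : (b i e : ℕ) ≤ (b (winner b e) e : ℕ) := le_winner b e i
  omega

theorem sum_payoff [Nonempty ι] (v : ι → Finset M → ℝ) (t lam : ℝ) (b : ι → M → Fin (K + 1)) :
    ∑ i, payoff v t lam i b
      = lam * ((Finset.univ.filter fun i => t ≤ v i (won b i)).card : ℝ) - revenue b := by
  have h : revenue b = ∑ i, ∑ e ∈ won b i, ((b i e : ℕ) : ℝ) := by
    rw [revenue, ← Finset.sum_fiberwise (s := Finset.univ) (g := winner b)]
    refine Finset.sum_congr rfl fun i _ => Finset.sum_congr rfl fun e he => ?_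
    rw [(Finset.mem_filter.mp he).2]
  simp only [payoff, Finset.sum_sub_distrib, h, ← Finset.mul_sum, Finset.sum_boole]

variable [DecidableEq M]

/-- The highest of the rival prices faced by `i` in the profiles `B s'`, `s' ≠ s`. -/
def ghostPrice {m : ℕ} (B : Fin (m + 1) → ι → M → Fin (K + 1)) (s : Fin (m + 1)) (i : ι)
    (e : M) : ℕ :=
  (Finset.univ.erase s).sup fun s' => rivalPrice (B s') i e

/-- The deviation that goes after the items of `P` only, bidding one more (but at most `K`) than
all the prices seen in the profiles `B s'`, `s' ≠ s`. -/
def ghostBid {m : ℕ} (B : Fin (m + 1) → ι → M → Fin (K + 1)) (s : Fin (m + 1)) (i : ι)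
    (P : Finset M) (e : M) : Fin (K + 1) :=
  if e ∈ P then ⟨min (ghostPrice B s i e + 1) K, by omega⟩ else 0

theorem ghostPrice_le_sum {m : ℕ} (B : Fin (m + 1) → ι → M → Fin (K + 1)) (s : Fin (m + 1))
    (i : ι) (e : M) :
    (ghostPrice B s i e : ℝ) ≤ ∑ s' ∈ Finset.univ.erase s, (rivalPrice (B s') i e : ℝ) := by
  have : ghostPrice B s i e ≤ ∑ s' ∈ Finset.univ.erase s, rivalPrice (B s') i e :=
    Finset.sup_le fun s' hs' =>
      Finset.single_le_sum (f := fun s' => rivalPrice (B s') i e) (fun _ _ => Nat.zero_le _) hs'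
  exact_mod_cast this

theorem ghostBid_update {m : ℕ} (B : Fin (m + 1) → ι → M → Fin (K + 1)) (s : Fin (m + 1)) (i : ι)
    (P : Finset M) (b : ι → M → Fin (K + 1)) :
    ghostBid (Function.update B s b) s i P = ghostBid B s i P := by
  have : ∀ e, ghostPrice (Function.update B s b) s i e = ghostPrice B s i e := fun e =>
    Finset.sup_congr rfl fun s' hs' => by
      rw [Function.update_of_ne (Finset.ne_of_mem_erase hs')]
  ext e
  simp only [ghostBid, this]

/-- If the profiles `B 0, …, B m` compete for a set worth `2 t`, then at most one of them can
defeat all the others on a part whose removal leaves less than `t`. -/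
theorem sum_fail_le_one {m : ℕ} (B : Fin (m + 1) → ι → M → Fin (K + 1)) (i : ι)
    {v : Finset M → ℝ} (hmono : Monotone v) (hsub : IsSubadditive v) {t : ℝ} {P : Finset M}
    (hP : 2 * t ≤ v P) :
    ∑ s : Fin (m + 1), (if v (P.filter fun e => rivalPrice (B s) i e ≤ ghostPrice B s i e) < t
      then (1 : ℝ) else 0) ≤ 1 := by
  rw [Finset.sum_boole]
  have : (Finset.univ.filter fun s : Fin (m + 1) =>
      v (P.filter fun e => rivalPrice (B s) i e ≤ ghostPrice B s i e) < t).card ≤ 1 := by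
    rw [Finset.card_le_one]
    intro s hs s' hs'
    rw [Finset.mem_filter] at hs hs'
    by_contra hne
    have hcov : P ⊆ (P.filter fun e => rivalPrice (B s) i e ≤ ghostPrice B s i e) ∪
        (P.filter fun e => rivalPrice (B s') i e ≤ ghostPrice B s' i e) := by
      intro e he
      rw [Finset.mem_union, Finset.mem_filter, Finset.mem_filter]
      rcases le_total (rivalPrice (B s) i e) (rivalPrice (B s') i e) with h | h
      · exact Or.inl ⟨he, h.trans (Finset.le_sup (f := fun r => rivalPrice (B r) i e)
          (Finset.mem_erase.mpr ⟨Ne.symm hne, Finset.mem_univ _⟩))⟩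
      · exact Or.inr ⟨he, h.trans (Finset.le_sup (f := fun r => rivalPrice (B r) i e)
          (Finset.mem_erase.mpr ⟨hne, Finset.mem_univ _⟩))⟩
    have := (hmono hcov).trans (hsub _ _)
    linarith [hs.2, hs'.2]
  exact_mod_cast this

/-- A lower bound for the payoff of the ghost-bid deviation: it pays at most the ghost prices plus
one per item, and it fails only if the ghosts lose too much or some rival bid is at the cap. -/
theorem payoff_ghostBid_ge [Nonempty ι] {v : ι → Finset M → ℝ} (hmono : ∀ i, Monotone (v i))
    {t lam : ℝ} (hlam : 0 ≤ lam) (hK : 0 < K) {m : ℕ} (B : Fin (m + 1) → ι → M → Fin (K + 1))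
    (s : Fin (m + 1)) (i : ι) (P : Finset M) :
    lam * (1 - (if v i (P.filter fun e => rivalPrice (B s) i e ≤ ghostPrice B s i e) < t
        then (1 : ℝ) else 0))
      - lam / K * ∑ e ∈ P, (rivalPrice (B s) i e : ℝ)
      - ∑ e ∈ P, (1 + ∑ s' ∈ Finset.univ.erase s, (rivalPrice (B s') i e : ℝ))
    ≤ payoff v t lam i (Function.update (B s) i (ghostBid B s i P)) := by
  set b' := Function.update (B s) i (ghostBid B s i P) with hb'
  have hKr : (0 : ℝ) < K := by exact_mod_cast hK
  have hbi : b' i = ghostBid B s i P := by simp [hb']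
  have hpay : ∑ e ∈ won b' i, ((b' i e : ℕ) : ℝ)
      ≤ ∑ e ∈ P, (1 + ∑ s' ∈ Finset.univ.erase s, (rivalPrice (B s') i e : ℝ)) := by
    have hle : ∑ e ∈ won b' i, ((b' i e : ℕ) : ℝ) ≤ ∑ e, ((b' i e : ℕ) : ℝ) :=
      Finset.sum_le_sum_of_subset_of_nonneg (Finset.subset_univ _) fun _ _ _ => Nat.cast_nonneg _
    refine hle.trans ?_
    rw [← Finset.sum_subset (Finset.subset_univ P) (fun e _ he => by
      rw [hbi]; simp [ghostBid, he])]
    refine Finset.sum_le_sum fun e he => ?_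
    have h1 : (b' i e : ℕ) ≤ ghostPrice B s i e + 1 := by
      rw [hbi]; simp [ghostBid, he]
    have h2 : ((b' i e : ℕ) : ℝ) ≤ ghostPrice B s i e + 1 := by exact_mod_cast h1
    linarith [ghostPrice_le_sum B s i e]
  have hwin : lam * (1 - (if v i (P.filter fun e => rivalPrice (B s) i e ≤ ghostPrice B s i e) < t
        then (1 : ℝ) else 0)) - lam / K * ∑ e ∈ P, (rivalPrice (B s) i e : ℝ)
      ≤ lam * (if t ≤ v i (won b' i) then 1 else 0) := by
    have hnn : 0 ≤ lam / K * ∑ e ∈ P, (rivalPrice (B s) i e : ℝ) := by positivity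
    by_cases hcap : ∃ e ∈ P, rivalPrice (B s) i e = K
    · obtain ⟨e, he, heK⟩ := hcap
      have h1 : (K : ℝ) ≤ ∑ e ∈ P, (rivalPrice (B s) i e : ℝ) := by
        have := Finset.single_le_sum (f := fun e => (rivalPrice (B s) i e : ℝ))
          (fun _ _ => Nat.cast_nonneg _) he
        simpa [heK] using this
      have h2 : lam ≤ lam / K * ∑ e ∈ P, (rivalPrice (B s) i e : ℝ) := by
        calc lam = lam / K * K := by field_simp
          _ ≤ _ := by gcongr
      have h3 : (0 : ℝ) ≤ lam * (if t ≤ v i (won b' i) then 1 else 0) := by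
        split_ifs <;> simp [hlam]
      have h4 : lam * (1 - (if v i (P.filter fun e =>
          rivalPrice (B s) i e ≤ ghostPrice B s i e) < t then (1 : ℝ) else 0)) ≤ lam := by
        split_ifs <;> simp [hlam]
      linarith
    · push Not at hcap
      by_cases hF : v i (P.filter fun e => rivalPrice (B s) i e ≤ ghostPrice B s i e) < t
      · have h3 : (0 : ℝ) ≤ lam * (if t ≤ v i (won b' i) then 1 else 0) := by
          split_ifs <;> simp [hlam]
        simp only [hF, if_true, sub_self, mul_zero]
        linarith
      · have hsubset : (P.filter fun e => rivalPrice (B s) i e ≤ ghostPrice B s i e)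
            ⊆ won b' i := by
          intro e he
          rw [Finset.mem_filter] at he
          rw [won, Finset.mem_filter]
          refine ⟨Finset.mem_univ _, winner_eq_of_rivalPrice_lt b' i e ?_⟩
          rw [hb', rivalPrice_update, Function.update_self]
          have h1 := rivalPrice_le (B s) i e
          have h2 := hcap e he.1
          simp only [ghostBid, he.1, if_true]
          have := he.2
          omega
        have : t ≤ v i (won b' i) := (not_lt.mp hF).trans (hmono i hsubset)
        simp only [hF, if_false, this, if_true]
        linarith
  rw [payoff]
  linarith

/-- Prices summed over disjoint pieces are at most the revenue. -/
theorem sum_pieces_le {N : ℕ} {P : Fin N → Finset M}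
    (hP : Pairwise fun l l' => Disjoint (P l) (P l')) (g : M → ℝ) (hg : ∀ e, 0 ≤ g e) :
    ∑ l, ∑ e ∈ P l, g e ≤ ∑ e, g e := by
  rw [← Finset.sum_biUnion fun l _ l' _ h => hP h]
  exact Finset.sum_le_sum_of_subset_of_nonneg (Finset.subset_univ _) fun e _ _ => hg e

theorem sum_rivalPrice_le_revenue [Nonempty ι] (b : ι → M → Fin (K + 1)) (i : ι) :
    ∑ e, (rivalPrice b i e : ℝ) ≤ revenue b :=
  Finset.sum_le_sum fun e _ => by exact_mod_cast rivalPrice_le_winner b i e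

/-- The total payoff of the ghost-bid deviations, over all choices of the target piece and of the
profile played by the rivals. -/
theorem sum_payoff_ghostBid_ge [Nonempty ι] {v : ι → Finset M → ℝ} (hmono : ∀ i, Monotone (v i))
    (hsub : ∀ i, IsSubadditive (v i)) {t lam : ℝ} (hlam : 0 ≤ lam) (hK : 0 < K) {m N : ℕ}
    (B : Fin (m + 1) → ι → M → Fin (K + 1)) (i : ι) {P : Fin N → Finset M}
    (hP : Pairwise fun l l' => Disjoint (P l) (P l')) (hPv : ∀ l, 2 * t ≤ v i (P l)) :
    lam * N * m - (m + 1) * Fintype.card M - (m + lam / K) * ∑ s, revenue (B s)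
    ≤ ∑ s, ∑ l, payoff v t lam i (Function.update (B s) i (ghostBid B s i (P l))) := by
  have hKr : (0 : ℝ) < K := by exact_mod_cast hK
  have h1 : ∀ s : Fin (m + 1),
      lam * N - lam * ∑ l, (if v i ((P l).filter fun e =>
          rivalPrice (B s) i e ≤ ghostPrice B s i e) < t then (1 : ℝ) else 0)
        - lam / K * revenue (B s) - Fintype.card M
        - ((∑ s', revenue (B s')) - revenue (B s))
      ≤ ∑ l, payoff v t lam i (Function.update (B s) i (ghostBid B s i (P l))) := by
    intro s
    refine le_trans ?_ (Finset.sum_le_sum fun l _ =>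
      payoff_ghostBid_ge hmono hlam hK B s i (P l))
    rw [Finset.sum_sub_distrib, Finset.sum_sub_distrib, ← Finset.mul_sum, ← Finset.mul_sum,
      Finset.sum_sub_distrib]
    simp only [Finset.sum_const, Finset.card_univ, Fintype.card_fin, nsmul_eq_mul, mul_one]
    have ha : ∑ l, ∑ e ∈ P l, (rivalPrice (B s) i e : ℝ) ≤ revenue (B s) :=
      (sum_pieces_le hP _ fun e => Nat.cast_nonneg _).trans (sum_rivalPrice_le_revenue _ _)
    have hb : ∑ l, ∑ e ∈ P l, (1 + ∑ s' ∈ Finset.univ.erase s, (rivalPrice (B s') i e : ℝ))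
        ≤ Fintype.card M + ((∑ s', revenue (B s')) - revenue (B s)) := by
      refine (sum_pieces_le hP _ fun e => by positivity).trans ?_
      rw [Finset.sum_add_distrib, Finset.sum_comm]
      simp only [Finset.sum_const, Finset.card_univ, nsmul_eq_mul, mul_one]
      have : ∑ s' ∈ Finset.univ.erase s, ∑ e, (rivalPrice (B s') i e : ℝ)
          ≤ ∑ s' ∈ Finset.univ.erase s, revenue (B s') :=
        Finset.sum_le_sum fun s' _ => sum_rivalPrice_le_revenue _ _
      have h2 : revenue (B s) + ∑ s' ∈ Finset.univ.erase s, revenue (B s')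
          = ∑ s', revenue (B s') :=
        Finset.add_sum_erase _ (fun s' => revenue (B s')) (Finset.mem_univ s)
      linarith
    have hc : lam / K * ∑ l, ∑ e ∈ P l, (rivalPrice (B s) i e : ℝ) ≤ lam / K * revenue (B s) := by
      gcongr
    linarith
  refine le_trans ?_ (Finset.sum_le_sum fun s _ => h1 s)
  simp only [Finset.sum_sub_distrib, ← Finset.mul_sum, Finset.sum_const, Finset.card_univ,
    Fintype.card_fin, nsmul_eq_mul]
  rw [Finset.sum_comm]
  have hF : ∑ l, ∑ s, (if v i ((P l).filter fun e =>
      rivalPrice (B s) i e ≤ ghostPrice B s i e) < t then (1 : ℝ) else 0) ≤ N := by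
    calc _ ≤ ∑ _l : Fin N, (1 : ℝ) :=
          Finset.sum_le_sum fun l _ => sum_fail_le_one B i (hmono i) (hsub i) (hPv l)
      _ = N := by simp
  have := mul_le_mul_of_nonneg_left hF hlam
  push_cast
  nlinarith

end Auction

/-- **One round of service.** If every one of `k` agents has `N > k * m` disjoint pieces worth
`2 t` each, then the items can be assigned so that at most `k / (m + 1)` agents get less
than `t`. -/
theorem exists_assignment_few_unserved {ι M : Type*} [Fintype ι] [DecidableEq ι] [Nonempty ι]
    [Fintype M] [DecidableEq M] {v : ι → Finset M → ℝ} (hmono : ∀ i, Monotone (v i))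
    (hsub : ∀ i, IsSubadditive (v i)) {t : ℝ} {N m : ℕ} (P : ι → Fin N → Finset M)
    (hP : ∀ i, Pairwise fun l l' => Disjoint (P i l) (P i l'))
    (hPv : ∀ i l, 2 * t ≤ v i (P i l)) (hm : Fintype.card ι * m < N) :
    ∃ a : M → ι, (m + 1) * (Finset.univ.filter fun i =>
      v i (Finset.univ.filter fun e => a e = i) < t).card ≤ Fintype.card ι := by
  set k := Fintype.card ι with hk
  have hkpos : 0 < k := Fintype.card_pos
  -- `lam` makes the rounding of bids negligible, and the cap `K` makes capped bids unprofitable.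
  set lam : ℕ := (m + 1) * (k * Fintype.card M) + 1 with hlam
  set K : ℕ := lam * k with hK
  have hKpos : 0 < K := Nat.mul_pos (Nat.succ_pos _) hkpos
  have hlam0 : (0 : ℝ) ≤ lam := Nat.cast_nonneg _
  obtain ⟨σ, hσ, hcce⟩ := exists_coarse_correlated_equilibrium
    (fun i (b : ι → M → Fin (K + 1)) => payoff v t (lam : ℝ) i b)
  set Rev : ℝ := ∑ b, σ b * revenue b with hRev
  set U : ι → ℝ := fun i => ∑ b, σ b * payoff v t (lam : ℝ) i b with hU
  have hw0 : ∀ B : Fin (m + 1) → ι → M → Fin (K + 1), 0 ≤ ∏ s, σ (B s) :=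
    fun B => Finset.prod_nonneg fun s _ => hσ.1 _
  have hw1 : ∑ B : Fin (m + 1) → ι → M → Fin (K + 1), ∏ s, σ (B s) = 1 :=
    sum_prod_weights (fun _ => σ) fun _ => hσ.2
  have hrev : ∑ B : Fin (m + 1) → ι → M → Fin (K + 1), (∏ s, σ (B s)) * ∑ s, revenue (B s)
      = (m + 1) * Rev := by
    have : ∀ s, ∑ B : Fin (m + 1) → ι → M → Fin (K + 1), (∏ s, σ (B s)) * revenue (B s)
        = Rev := by
      intro s
      rw [← sum_prod_weights_resample (fun _ : Fin (m + 1) => σ) s hσ.2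
        (fun B => revenue (B s))]
      simp only [Function.update_self]
      rw [← Finset.sum_mul, hw1, one_mul]
    simp_rw [Finset.mul_sum]
    rw [Finset.sum_comm, Finset.sum_congr rfl fun s _ => this s]
    simp
  have hdev : ∀ i, ∑ B : Fin (m + 1) → ι → M → Fin (K + 1), (∏ s, σ (B s)) *
      ∑ s, ∑ l, payoff v t (lam : ℝ) i (Function.update (B s) i (ghostBid B s i (P i l)))
      ≤ (m + 1) * (N * U i) := by
    intro i
    have : ∀ s l, ∑ B : Fin (m + 1) → ι → M → Fin (K + 1), (∏ s, σ (B s)) *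
        payoff v t (lam : ℝ) i (Function.update (B s) i (ghostBid B s i (P i l))) ≤ U i := by
      intro s l
      rw [← sum_prod_weights_resample (fun _ : Fin (m + 1) => σ) s hσ.2
        (fun B => payoff v t (lam : ℝ) i (Function.update (B s) i (ghostBid B s i (P i l))))]
      simp only [Function.update_self, ghostBid_update]
      calc _ ≤ ∑ B : Fin (m + 1) → ι → M → Fin (K + 1), (∏ s, σ (B s)) * U i :=
            Finset.sum_le_sum fun B _ => mul_le_mul_of_nonneg_left (hcce i _) (hw0 B)
        _ = U i := by rw [← Finset.sum_mul, hw1, one_mul]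
    simp_rw [Finset.mul_sum]
    rw [Finset.sum_comm]
    calc _ ≤ ∑ _s : Fin (m + 1), ∑ _l : Fin N, U i := by
          refine Finset.sum_le_sum fun s _ => ?_
          rw [Finset.sum_comm]
          exact Finset.sum_le_sum fun l _ => this s l
      _ = _ := by simp
  have hi : ∀ i, (lam : ℝ) * N * m - (m + 1) * Fintype.card M
      - (m + lam / K) * ((m + 1) * Rev) ≤ (m + 1) * (N * U i) := by
    intro i
    refine le_trans (le_of_eq ?_) ((Finset.sum_le_sum fun B _ => mul_le_mul_of_nonneg_left
      (sum_payoff_ghostBid_ge hmono hsub hlam0 hKpos B i (hP i) (hPv i)) (hw0 B)).trans (hdev i))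
    simp_rw [mul_sub (∏ s, σ _)]
    rw [Finset.sum_sub_distrib, Finset.sum_sub_distrib, ← Finset.sum_mul, ← Finset.sum_mul, hw1,
      ← hrev, Finset.mul_sum]
    congr 1
    · ring
    · exact Finset.sum_congr rfl fun B _ => by ring
  set S : (ι → M → Fin (K + 1)) → ℝ :=
    fun b => ((Finset.univ.filter fun i => t ≤ v i (won b i)).card : ℝ) with hS
  have hsumU : ∑ i, U i = lam * (∑ b, σ b * S b) - Rev := by
    simp only [hU]
    rw [Finset.sum_comm, Finset.mul_sum, hRev, ← Finset.sum_sub_distrib]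
    refine Finset.sum_congr rfl fun b _ => ?_
    rw [← Finset.mul_sum, sum_payoff]
    ring
  have hRev0 : 0 ≤ Rev := Finset.sum_nonneg fun b _ => mul_nonneg (hσ.1 b)
    (Finset.sum_nonneg fun e _ => Nat.cast_nonneg _)
  have htot : (k : ℝ) * ((lam : ℝ) * N * m - (m + 1) * Fintype.card M
      - (m + lam / K) * ((m + 1) * Rev)) ≤ (m + 1) * (N * (lam * (∑ b, σ b * S b) - Rev)) := by
    have hs := Finset.sum_le_sum fun i (_ : i ∈ Finset.univ) => hi i
    rw [Finset.sum_const, Finset.card_univ, nsmul_eq_mul, ← Finset.mul_sum, ← Finset.mul_sum,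
      hsumU] at hs
    exact hs
  have hkr : (0 : ℝ) < k := by exact_mod_cast hkpos
  have hlampos : (0 : ℝ) < lam := by rw [hlam]; positivity
  have hlk : (k : ℝ) * (m + lam / K) ≤ N := by
    have h1 : (k : ℝ) * (m + lam / K) = k * m + 1 := by
      rw [hK]; push_cast; field_simp
    rw [h1]
    exact_mod_cast hm
  have hNpos : (1 : ℝ) ≤ N := by exact_mod_cast (by omega : 1 ≤ N)
  have hmain : (k : ℝ) * m - 1 < (m + 1) * ∑ b, σ b * S b := by
    have h1 : (k : ℝ) * (m + lam / K) * ((m + 1) * Rev) ≤ N * ((m + 1) * Rev) := by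
      gcongr
    have h2 : (k : ℝ) * ((lam : ℝ) * N * m - (m + 1) * Fintype.card M)
        ≤ (m + 1) * (N * (lam * ∑ b, σ b * S b)) := by linarith
    have h3 : (k : ℝ) * ((m + 1) * Fintype.card M) < lam * N := by
      have : (lam : ℝ) = (m + 1) * (k * Fintype.card M) + 1 := by rw [hlam]; push_cast; ring
      calc (k : ℝ) * ((m + 1) * Fintype.card M) < lam := by rw [this]; linarith
        _ ≤ lam * N := le_mul_of_one_le_right hlam0 hNpos
    have h4 : (lam * N : ℝ) * (k * m - 1) < (lam * N) * ((m + 1) * ∑ b, σ b * S b) := by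
      linarith
    exact lt_of_mul_lt_mul_left h4 (by positivity)
  obtain ⟨b, hb⟩ : ∃ b, (k : ℝ) * m - 1 < (m + 1) * S b := by
    by_contra! hcon
    have : (m + 1 : ℝ) * ∑ b, σ b * S b ≤ ∑ b, σ b * ((k : ℝ) * m - 1) := by
      rw [Finset.mul_sum]
      refine Finset.sum_le_sum fun b _ => ?_
      have := mul_le_mul_of_nonneg_left (hcon b) (hσ.1 b)
      linarith
    rw [← Finset.sum_mul, hσ.2, one_mul] at this
    linarith
  refine ⟨winner b, ?_⟩
  have hcompl : (Finset.univ.filter fun i => t ≤ v i (won b i)).card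
      + (Finset.univ.filter fun i => v i (won b i) < t).card = k := by
    have := Finset.card_filter_add_card_filter_not (s := (Finset.univ : Finset ι))
      (fun i => t ≤ v i (won b i))
    simpa [not_le, hk] using this
  have hb' : k * m < (m + 1) * (Finset.univ.filter fun i => t ≤ v i (won b i)).card + 1 := by
    have : (k : ℝ) * m < (m + 1) *
        ((Finset.univ.filter fun i => t ≤ v i (won b i)).card : ℝ) + 1 := by linarith
    exact_mod_cast this
  change (m + 1) * (Finset.univ.filter fun i => v i (won b i) < t).card ≤ k
  nlinarith

/-! ### Splitting sets of small items -/

theorem IsSubadditive.nonneg {M : Type*} [DecidableEq M] {v : Finset M → ℝ}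
    (hmono : Monotone v) (hsub : IsSubadditive v) (S : Finset M) : 0 ≤ v S := by
  have h1 := hsub ∅ ∅
  have h2 := hmono (Finset.empty_subset S)
  rw [Finset.empty_union] at h1
  linarith

/-- A set all of whose one-item deletions are worth less than `c` is worth less than `c + t`,
provided single items are worth less than `t`. -/
theorem lt_add_of_forall_erase_lt {M : Type*} [DecidableEq M] {v : Finset M → ℝ}
    (hsub : IsSubadditive v) {t c : ℝ} {S : Finset M} (hS : S.Nonempty)
    (hsmall : ∀ e ∈ S, v {e} < t) (herase : ∀ e ∈ S, v (S.erase e) < c) : v S < c + t := by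
  obtain ⟨e, he⟩ := hS
  have h := hsub {e} (S.erase e)
  rw [← Finset.insert_eq, Finset.insert_erase he] at h
  linarith [hsmall e he, herase e he]

/-- A set of small items splits into disjoint pieces worth between `2 * t` and `3 * t`, up to a
remainder worth at most `2 * t`. -/
theorem exists_pieces {M : Type*} [DecidableEq M] {v : Finset M → ℝ} (hmono : Monotone v)
    (hsub : IsSubadditive v) {t : ℝ} (S : Finset M)
    (hsmall : ∀ T ⊆ S, T.card ≤ 1 → v T < t) :
    ∃ (N : ℕ) (P : Fin N → Finset M), (Pairwise fun l l' => Disjoint (P l) (P l')) ∧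
      (∀ l, P l ⊆ S) ∧ (∀ l, 2 * t ≤ v (P l)) ∧ v S ≤ 3 * t * N + 2 * t := by
  induction S using Finset.strongInduction with
  | H S ih =>
    have ht : 0 < t := (hsub.nonneg hmono ∅).trans_lt (hsmall ∅ (Finset.empty_subset _) (by simp))
    by_cases hv : v S < 2 * t
    · exact ⟨0, Fin.elim0, fun l => l.elim0, fun l => l.elim0, fun l => l.elim0, by simp [hv.le]⟩
    · rw [not_lt] at hv
      obtain ⟨T, hT, hmin⟩ := Finset.exists_min_image (S.powerset.filter fun T => 2 * t ≤ v T)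
        Finset.card ⟨S, by simp [hv]⟩
      rw [Finset.mem_filter, Finset.mem_powerset] at hT
      obtain ⟨hTS, hTv⟩ := hT
      have hTne : T.Nonempty := by
        rw [Finset.nonempty_iff_ne_empty]
        rintro rfl
        linarith [hsmall ∅ (Finset.empty_subset _) (by simp)]
      have hlt : v T < 2 * t + t := by
        refine lt_add_of_forall_erase_lt hsub hTne (fun e he => hsmall {e} (by simpa using hTS he)
          (by simp)) fun e he => ?_
        by_contra! hcon
        have := hmin (T.erase e) (by
          rw [Finset.mem_filter, Finset.mem_powerset]
          exact ⟨(Finset.erase_subset _ _).trans hTS, hcon⟩)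
        exact absurd this (not_le.mpr (Finset.card_erase_lt_of_mem he))
      obtain ⟨N, P, hd, hPS, hPv, hle⟩ := ih (S \ T) (Finset.sdiff_ssubset hTS hTne)
        fun T' hT' => hsmall T' (hT'.trans Finset.sdiff_subset)
      refine ⟨N + 1, Fin.cons T P, ?_, ?_, ?_, ?_⟩
      · have hTP : ∀ l, Disjoint T (P l) := fun l =>
          Finset.disjoint_of_subset_right (hPS l) Finset.disjoint_sdiff
        intro l l' hll
        induction l using Fin.cases with
        | zero =>
          induction l' using Fin.cases with
          | zero => exact absurd rfl hll
          | succ l' => simpa using hTP l'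
        | succ l =>
          induction l' using Fin.cases with
          | zero => simpa using (hTP l).symm
          | succ l' => simpa using hd (fun h => hll (by rw [h]))
      · intro l
        induction l using Fin.cases with
        | zero => simpa using hTS
        | succ l => simpa using (hPS l).trans Finset.sdiff_subset
      · intro l
        induction l using Fin.cases with
        | zero => simpa using hTv
        | succ l => simpa using hPv l
      · have h := hsub T (S \ T)
        rw [Finset.union_sdiff_of_subset hTS] at h
        push_cast
        linarith

/-- Pieces worth at least `2 * t`, collected over a disjoint family of sets of small items. -/
theorem exists_pieces_of_family {M : Type*} [DecidableEq M] {v : Finset M → ℝ}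
    (hmono : Monotone v) (hsub : IsSubadditive v) {t : ℝ} {n : ℕ} (C : Fin n → Finset M)
    (hC : Pairwise fun j j' => Disjoint (C j) (C j'))
    (hsmall : ∀ j, ∀ T ⊆ C j, T.card ≤ 1 → v T < t) :
    ∃ (N : ℕ) (P : Fin N → Finset M), (Pairwise fun l l' => Disjoint (P l) (P l')) ∧
      (∀ l, ∃ j, P l ⊆ C j) ∧ (∀ l, 2 * t ≤ v (P l)) ∧ ∑ j, v (C j) - 2 * t * n ≤ 3 * t * N := by
  choose N P hd hPC hPv hle using fun j => exists_pieces hmono hsub (C j) (hsmall j)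
  refine ⟨∑ j, N j, fun l => P (finSigmaFinEquiv.symm l).1 (finSigmaFinEquiv.symm l).2, ?_,
    fun l => ⟨_, hPC _ _⟩, fun l => hPv _ _, ?_⟩
  · intro l l' hll
    change Disjoint (P (finSigmaFinEquiv.symm l).1 (finSigmaFinEquiv.symm l).2)
      (P (finSigmaFinEquiv.symm l').1 (finSigmaFinEquiv.symm l').2)
    have hne : finSigmaFinEquiv.symm l ≠ finSigmaFinEquiv.symm l' :=
      fun h => hll (finSigmaFinEquiv.symm.injective h)
    revert hne
    generalize finSigmaFinEquiv.symm l = x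
    generalize finSigmaFinEquiv.symm l' = y
    obtain ⟨j, a⟩ := x
    obtain ⟨j', a'⟩ := y
    intro hne
    by_cases hj : j = j'
    · subst hj
      exact hd j fun h : a = a' => hne (by rw [h])
    · exact Finset.disjoint_of_subset_left (hPC j a)
        (Finset.disjoint_of_subset_right (hPC j' a') (hC hj))
  · have := Finset.sum_le_sum fun j (_ : j ∈ Finset.univ) => hle j
    rw [Finset.sum_add_distrib, ← Finset.mul_sum, Finset.sum_const, Finset.card_univ,
      Fintype.card_fin, nsmul_eq_mul] at this
    push_cast
    linarith

/-! ### Random colourings -/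

/-- Under a uniformly random colouring, a quantity determined by the colours on `S` and a quantity
determined by the colours off `S` are uncorrelated. -/
theorem card_mul_sum_mul_eq {M C : Type*} [Fintype M] [DecidableEq M] [Fintype C]
    (S : Finset M) (F G : (M → C) → ℝ)
    (hF : ∀ χ χ' : M → C, (∀ e ∈ S, χ e = χ' e) → F χ = F χ')
    (hG : ∀ χ χ' : M → C, (∀ e ∉ S, χ e = χ' e) → G χ = G χ') :
    (Fintype.card (M → C) : ℝ) * ∑ χ, F χ * G χ = (∑ χ, F χ) * ∑ χ, G χ := by
  let e : (M → C) × (M → C) → (M → C) × (M → C) :=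
    fun p => (S.piecewise p.1 p.2, S.piecewise p.2 p.1)
  have he : Function.Involutive e := by
    rintro ⟨χ, χ'⟩
    ext x <;> by_cases hx : x ∈ S <;> simp [e, hx]
  calc (Fintype.card (M → C) : ℝ) * ∑ χ, F χ * G χ
      = ∑ p : (M → C) × (M → C), F p.1 * G p.1 := by
        rw [Fintype.sum_prod_type, Finset.mul_sum]
        simp
    _ = ∑ p : (M → C) × (M → C), F (e p).1 * G (e p).1 :=
        (Equiv.sum_comp he.toPerm fun p : (M → C) × (M → C) => F p.1 * G p.1).symm
    _ = ∑ p : (M → C) × (M → C), F p.1 * G p.2 := by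
        refine Finset.sum_congr rfl fun p _ => ?_
        rw [hF (e p).1 p.1 fun x hx => by simp [e, hx],
          hG (e p).1 p.2 fun x hx => by simp [e, hx]]
    _ = (∑ χ, F χ) * ∑ χ, G χ := by
        rw [Finset.sum_mul_sum, Fintype.sum_prod_type]

/-- Quantities determined by the colours on disjoint sets have independent averages: if each
averages to at most `q`, their product averages to at most the corresponding power of `q`. -/
theorem sum_prod_le_pow {M C J : Type*} [Fintype M] [DecidableEq M] [Fintype C] [Nonempty C]
    [DecidableEq J] (s : Finset J) (S : J → Finset M)
    (hS : Pairwise fun j j' => Disjoint (S j) (S j')) (F : J → (M → C) → ℝ)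
    (hF : ∀ j, ∀ χ χ' : M → C, (∀ e ∈ S j, χ e = χ' e) → F j χ = F j χ')
    (hF0 : ∀ j χ, 0 ≤ F j χ) {q : ℝ} (hq : ∀ j, ∑ χ, F j χ ≤ q * Fintype.card (M → C)) :
    ∑ χ, ∏ j ∈ s, F j χ ≤ q ^ s.card * Fintype.card (M → C) := by
  have hT : (0 : ℝ) < Fintype.card (M → C) := by exact_mod_cast Fintype.card_pos
  induction s using Finset.induction_on with
  | empty => simp
  | insert j s hj ih =>
    have h := card_mul_sum_mul_eq (S j) (F j) (fun χ => ∏ j' ∈ s, F j' χ) (hF j)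
      (fun χ χ' hχ => Finset.prod_congr rfl fun j' hj' => hF j' χ χ' fun e he => hχ e fun he' =>
        Finset.disjoint_left.mp (hS fun h : j' = j => hj (h ▸ hj')) he he')
    have h1 : 0 ≤ ∑ χ, F j χ := Finset.sum_nonneg fun χ _ => hF0 j χ
    have h2 : 0 ≤ ∑ χ, ∏ j' ∈ s, F j' χ :=
      Finset.sum_nonneg fun χ _ => Finset.prod_nonneg fun j' _ => hF0 j' χ
    have h3 := mul_le_mul (hq j) ih h2 (h1.trans (hq j))
    rw [← h] at h3
    simp_rw [Finset.prod_insert hj]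
    rw [Finset.card_insert_of_notMem hj, pow_succ]
    refine le_of_mul_le_mul_left (h3.trans (le_of_eq ?_)) hT
    ring

theorem IsSubadditive.le_sum_biUnion {M I : Type*} [DecidableEq M] {v : Finset M → ℝ}
    (hsub : IsSubadditive v) {s : Finset I} (hs : s.Nonempty) (f : I → Finset M) :
    v (s.biUnion f) ≤ ∑ i ∈ s, v (f i) := by
  classical
  induction hs using Finset.Nonempty.cons_induction with
  | singleton a => simp
  | cons a s ha hs ih =>
    rw [Finset.sum_cons, Finset.cons_eq_insert, Finset.biUnion_insert]
    exact (hsub _ _).trans (by linarith)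

theorem one_le_sum_min_one {M : Type*} [DecidableEq M] {v : Finset M → ℝ} (hmono : Monotone v)
    (hsub : IsSubadditive v) {R : ℕ} (hR : 0 < R) {B : Finset M} (hB : 1 ≤ v B) (χ : M → Fin R) :
    1 ≤ ∑ r, min 1 (v (B.filter fun e => χ e = r)) := by
  have h0 : ∀ r, 0 ≤ min 1 (v (B.filter fun e => χ e = r)) := fun r =>
    le_min zero_le_one (hsub.nonneg hmono _)
  by_cases h : ∃ r, 1 ≤ v (B.filter fun e => χ e = r)
  · obtain ⟨r, hr⟩ := h
    calc 1 = min 1 (v (B.filter fun e => χ e = r)) := (min_eq_left hr).symm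
      _ ≤ _ := Finset.single_le_sum (f := fun r => min 1 (v (B.filter fun e => χ e = r)))
          (fun r _ => h0 r) (Finset.mem_univ r)
  · push Not at h
    have : Nonempty (Fin R) := ⟨⟨0, hR⟩⟩
    have h1 := hsub.le_sum_biUnion (Finset.univ_nonempty (α := Fin R))
      fun r => B.filter fun e => χ e = r
    have h2 : (Finset.univ.biUnion fun r => B.filter fun e => χ e = r) = B := by
      ext e
      simp
    rw [h2] at h1
    refine hB.trans (h1.trans (Finset.sum_le_sum fun r _ => ?_))
    rw [min_eq_right (h r).le]

/-- The share of `B` in a fixed colour class, capped at one, is on average at least `1 / R`. -/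
theorem card_le_mul_sum_min_one {M : Type*} [Fintype M] [DecidableEq M] {v : Finset M → ℝ}
    (hmono : Monotone v) (hsub : IsSubadditive v) {R : ℕ} (hR : 0 < R) {B : Finset M}
    (hB : 1 ≤ v B) (r : Fin R) :
    (Fintype.card (M → Fin R) : ℝ)
      ≤ R * ∑ χ : M → Fin R, min 1 (v (B.filter fun e => χ e = r)) := by
  -- All colours behave alike, by symmetry.
  have hsymm : ∀ r', ∑ χ : M → Fin R, min 1 (v (B.filter fun e => χ e = r'))
      = ∑ χ : M → Fin R, min 1 (v (B.filter fun e => χ e = r)) := by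
    intro r'
    rw [← Equiv.sum_comp (Equiv.arrowCongr (Equiv.refl M) (Equiv.swap r r'))]
    refine Finset.sum_congr rfl fun χ _ => ?_
    congr 2
    refine Finset.filter_congr fun e _ => ?_
    simp only [Equiv.arrowCongr_apply, Function.comp]
    rw [Equiv.swap_apply_eq_iff]
    simp
  calc (Fintype.card (M → Fin R) : ℝ) = ∑ _χ : M → Fin R, (1 : ℝ) := by simp
    _ ≤ ∑ χ : M → Fin R, ∑ r', min 1 (v (B.filter fun e => χ e = r')) :=
        Finset.sum_le_sum fun χ _ => one_le_sum_min_one hmono hsub hR hB χ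
    _ = _ := by
        rw [Finset.sum_comm, Finset.sum_congr rfl fun r' _ => hsymm r']
        simp

theorem exp_neg_le_of_mem_Icc {y : ℝ} (h0 : 0 ≤ y) (h1 : y ≤ 1) :
    Real.exp (-y) ≤ 1 - (1 - Real.exp (-1)) * y := by
  have h := convexOn_exp.2 (Set.mem_univ (0 : ℝ)) (Set.mem_univ (-1 : ℝ))
    (sub_nonneg.mpr h1) h0 (by ring)
  simp only [smul_eq_mul, mul_zero, zero_add, Real.exp_zero, mul_one, mul_neg_one] at h
  linarith

/-- A Chernoff bound for the number of colourings under which the colour class `r` contains less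
than half of its expected share of `n` disjoint bundles worth one. -/
theorem card_bad_coloring_le {M : Type*} [Fintype M] [DecidableEq M] {v : Finset M → ℝ}
    (hmono : Monotone v) (hsub : IsSubadditive v) {n R : ℕ} (hR : 0 < R) (B : Fin n → Finset M)
    (hd : Pairwise fun j j' => Disjoint (B j) (B j')) (hB : ∀ j, 1 ≤ v (B j)) (r : Fin R) :
    ((Finset.univ.filter fun χ : M → Fin R =>
        ∑ j, min 1 (v ((B j).filter fun e => χ e = r)) < n / (2 * R)).card : ℝ)
      ≤ Real.exp (n / (2 * R)) * (1 - (1 - Real.exp (-1)) / R) ^ n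
        * Fintype.card (M → Fin R) := by
  have : Nonempty (Fin R) := ⟨⟨0, hR⟩⟩
  have hRr : (0 : ℝ) < R := by exact_mod_cast hR
  set y : Fin n → (M → Fin R) → ℝ := fun j χ => min 1 (v ((B j).filter fun e => χ e = r)) with hy
  have hmgf : ∀ j, ∑ χ, Real.exp (-y j χ)
      ≤ (1 - (1 - Real.exp (-1)) / R) * Fintype.card (M → Fin R) := by
    intro j
    have h1 := card_le_mul_sum_min_one hmono hsub hR (hB j) r
    have h2 : ∑ χ, Real.exp (-y j χ) ≤ ∑ χ, (1 - (1 - Real.exp (-1)) * y j χ) :=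
      Finset.sum_le_sum fun χ _ =>
        exp_neg_le_of_mem_Icc (le_min zero_le_one (hsub.nonneg hmono _)) (min_le_left _ _)
    rw [Finset.sum_sub_distrib, ← Finset.mul_sum] at h2
    simp only [Finset.sum_const, Finset.card_univ, nsmul_eq_mul, mul_one] at h2
    have h3 : 0 ≤ 1 - Real.exp (-1) := by
      have := Real.exp_neg_one_lt_d9
      linarith
    have h4 : (Fintype.card (M → Fin R) : ℝ) / R ≤ ∑ χ, y j χ := by
      rw [div_le_iff₀ hRr]
      linarith
    have h5 := mul_le_mul_of_nonneg_left h4 h3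
    calc _ ≤ _ := h2
      _ ≤ Fintype.card (M → Fin R) - (1 - Real.exp (-1)) * (Fintype.card (M → Fin R) / R) := by
        linarith
      _ = _ := by ring
  have hprod := sum_prod_le_pow Finset.univ B hd (fun j χ => Real.exp (-y j χ))
    (fun j χ χ' h => by
      have : (B j).filter (fun e => χ e = r) = (B j).filter fun e => χ' e = r :=
        Finset.filter_congr fun e he => by rw [h e he]
      simp only [hy, this])
    (fun j χ => (Real.exp_pos _).le) hmgf
  rw [Finset.card_univ, Fintype.card_fin] at hprod
  rw [mul_assoc]
  refine le_trans ?_ (mul_le_mul_of_nonneg_left hprod (Real.exp_pos _).le)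
  rw [Finset.mul_sum, ← Finset.sum_boole]
  refine Finset.sum_le_sum fun χ _ => ?_
  rw [← Real.exp_sum, ← Real.exp_add, Finset.sum_neg_distrib]
  split_ifs with h
  · exact Real.one_le_exp (by linarith)
  · exact (Real.exp_pos _).le

/-- If the Chernoff bounds sum to less than one, some colouring gives every colour class, in the
eyes of every agent, half of its expected share of the bundles. -/
theorem exists_balanced_coloring {ι M : Type*} [Fintype M] [DecidableEq M] (U : Finset ι)
    {v : ι → Finset M → ℝ} (hmono : ∀ i, Monotone (v i)) (hsub : ∀ i, IsSubadditive (v i))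
    {n R : ℕ} (hR : 0 < R) (B : ι → Fin n → Finset M)
    (hd : ∀ i ∈ U, Pairwise fun j j' => Disjoint (B i j) (B i j'))
    (hB : ∀ i ∈ U, ∀ j, 1 ≤ v i (B i j))
    (htail : (U.card : ℝ) * R *
      (Real.exp (n / (2 * R)) * (1 - (1 - Real.exp (-1)) / R) ^ n) < 1) :
    ∃ χ : M → Fin R, ∀ i ∈ U, ∀ r,
      (n : ℝ) / (2 * R) ≤ ∑ j, min 1 (v i ((B i j).filter fun e => χ e = r)) := by
  classical
  have : Nonempty (Fin R) := ⟨⟨0, hR⟩⟩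
  by_contra! hcon
  set p : ℝ := Real.exp (n / (2 * R)) * (1 - (1 - Real.exp (-1)) / R) ^ n with hp
  set bad : ι × Fin R → Finset (M → Fin R) := fun x => Finset.univ.filter fun χ =>
    ∑ j, min 1 (v x.1 ((B x.1 j).filter fun e => χ e = x.2)) < n / (2 * R) with hbad
  have hcover : (Finset.univ : Finset (M → Fin R)) ⊆ (U ×ˢ Finset.univ).biUnion bad := by
    intro χ _
    obtain ⟨i, hi, r, hr⟩ := hcon χ
    rw [Finset.mem_biUnion]
    exact ⟨(i, r), by simp [hi], by simpa [hbad] using hr⟩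
  have h1 : (Fintype.card (M → Fin R) : ℝ) ≤ ∑ x ∈ U ×ˢ Finset.univ, ((bad x).card : ℝ) := by
    exact_mod_cast (Finset.card_le_card hcover).trans Finset.card_biUnion_le
  have h2 : ∑ x ∈ U ×ˢ (Finset.univ : Finset (Fin R)), ((bad x).card : ℝ)
      ≤ ∑ _x ∈ U ×ˢ (Finset.univ : Finset (Fin R)), p * Fintype.card (M → Fin R) :=
    Finset.sum_le_sum fun x hx => card_bad_coloring_le (hmono _) (hsub _) hR _
      (hd _ (Finset.mem_product.mp hx).1) (hB _ (Finset.mem_product.mp hx).1) x.2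
  rw [Finset.sum_const, Finset.card_product, Finset.card_univ, Fintype.card_fin, nsmul_eq_mul]
    at h2
  push_cast at h2
  have hT : (0 : ℝ) < Fintype.card (M → Fin R) := by exact_mod_cast Fintype.card_pos
  nlinarith

/-! ### Serving the agents in rounds -/

section Rounds

variable {ι M : Type*} [DecidableEq ι] [Fintype M] [DecidableEq M]

/-- `exists_assignment_few_unserved` for a set `U` of agents and a set `X` of items. -/
theorem exists_allocation_few_unserved {v : ι → Finset M → ℝ} (hmono : ∀ i, Monotone (v i))
    (hsub : ∀ i, IsSubadditive (v i)) {t : ℝ} (U : Finset ι) (X : Finset M) {N m : ℕ}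
    (P : ι → Fin N → Finset M)
    (hP : ∀ i ∈ U, Pairwise fun l l' => Disjoint (P i l) (P i l'))
    (hPX : ∀ i ∈ U, ∀ l, P i l ⊆ X) (hPv : ∀ i ∈ U, ∀ l, 2 * t ≤ v i (P i l))
    (hm : U.card * m < N) :
    ∃ A : ι → Finset M, (Pairwise fun i i' => Disjoint (A i) (A i')) ∧ (∀ i, A i ⊆ X) ∧
      (m + 1) * (U.filter fun i => v i (A i) < t).card ≤ U.card := by
  rcases U.eq_empty_or_nonempty with rfl | hU
  · exact ⟨fun _ => ∅, fun _ _ _ => Finset.disjoint_empty_left _, fun _ => Finset.empty_subset _,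
      by simp⟩
  have : Nonempty U := hU.to_subtype
  obtain ⟨a, ha⟩ := exists_assignment_few_unserved (ι := U) (v := fun i S => v i (S ∩ X))
    (fun i S T hST => hmono i (Finset.inter_subset_inter_right hST))
    (fun i S T => by
      simpa only [Finset.union_inter_distrib_right] using hsub i (S ∩ X) (T ∩ X))
    (t := t) (m := m) (fun i => P i) (fun i => hP i i.2)
    (fun i l => by rw [Finset.inter_eq_left.mpr (hPX i i.2 l)]; exact hPv i i.2 l)
    (by rwa [Fintype.card_coe])
  rw [Fintype.card_coe] at ha
  refine ⟨fun i => X.filter fun e => (a e : ι) = i, ?_, fun i => Finset.filter_subset _ _, ?_⟩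
  · intro i i' hne
    rw [Finset.disjoint_left]
    intro e he he'
    exact hne ((Finset.mem_filter.mp he).2.symm.trans (Finset.mem_filter.mp he').2)
  · refine le_trans (Nat.mul_le_mul_left _ ?_) ha
    refine le_trans (Finset.card_le_card fun i hi => ?_)
      (Finset.card_image_le (f := (Subtype.val : U → ι)))
    rw [Finset.mem_filter] at hi
    rw [Finset.mem_image]
    refine ⟨⟨i, hi.1⟩, ?_, rfl⟩
    rw [Finset.mem_filter]
    refine ⟨Finset.mem_univ _, lt_of_eq_of_lt (congrArg (v i) ?_) hi.2⟩
    ext e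
    simp [Subtype.ext_iff, and_comm]

/-- If `k` agents have at least `w` disjoint pieces worth `2 * t` each, a round of service leaves
at most `k ^ 2 / w` of them unserved. -/
theorem exists_allocation_unserved_mul_le {v : ι → Finset M → ℝ} (hmono : ∀ i, Monotone (v i))
    (hsub : ∀ i, IsSubadditive (v i)) {t : ℝ} (U : Finset ι) (X : Finset M) {w : ℝ} (hw : 0 < w)
    (hP : ∀ i ∈ U, ∃ (N : ℕ) (P : Fin N → Finset M),
      (Pairwise fun l l' => Disjoint (P l) (P l')) ∧ (∀ l, P l ⊆ X) ∧
      (∀ l, 2 * t ≤ v i (P l)) ∧ w ≤ N) :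
    ∃ A : ι → Finset M, (Pairwise fun i i' => Disjoint (A i) (A i')) ∧ (∀ i, A i ⊆ X) ∧
      ((U.filter fun i => v i (A i) < t).card : ℝ) * w ≤ (U.card : ℝ) ^ 2 := by
  rcases U.eq_empty_or_nonempty with rfl | hU
  · exact ⟨fun _ => ∅, fun _ _ _ => Finset.disjoint_empty_left _, fun _ => Finset.empty_subset _,
      by simp⟩
  have hP' : ∀ i, ∃ P : Fin ⌈w⌉₊ → Finset M, i ∈ U →
      (Pairwise fun l l' => Disjoint (P l) (P l')) ∧ (∀ l, P l ⊆ X) ∧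
      (∀ l, 2 * t ≤ v i (P l)) := by
    intro i
    by_cases hi : i ∈ U
    · obtain ⟨N, P, h1, h2, h3, h4⟩ := hP i hi
      have hN : ⌈w⌉₊ ≤ N := Nat.ceil_le.mpr h4
      exact ⟨fun l => P (Fin.castLE hN l), fun _ => ⟨fun l l' hne =>
        h1 fun h => hne (Fin.castLE_injective hN h), fun l => h2 _, fun l => h3 _⟩⟩
    · exact ⟨fun _ => ∅, fun h => absurd h hi⟩
  choose P hP' using hP'
  have hk : (0 : ℝ) < U.card := by exact_mod_cast hU.card_pos
  -- `m` is the largest integer with `k * m < w`.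
  obtain ⟨m, hm⟩ : ∃ m, ⌈w / U.card⌉₊ = m + 1 :=
    Nat.exists_eq_succ_of_ne_zero (Nat.ceil_pos.mpr (div_pos hw hk)).ne'
  have hm1 : (U.card : ℝ) * m < w := by
    have : (m : ℝ) < w / U.card := Nat.lt_ceil.mp (by omega)
    rw [lt_div_iff₀ hk] at this
    linarith
  have hm2 : w ≤ U.card * (m + 1) := by
    have : w / U.card ≤ ((m + 1 : ℕ) : ℝ) := hm ▸ Nat.le_ceil _
    rw [div_le_iff₀ hk] at this
    push_cast at this
    linarith
  obtain ⟨A, hA1, hA2, hA3⟩ := exists_allocation_few_unserved hmono hsub (t := t) U X P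
    (fun i hi => (hP' i hi).1) (fun i hi => (hP' i hi).2.1) (fun i hi => (hP' i hi).2.2) (m := m)
    (by exact_mod_cast hm1.trans_le (Nat.le_ceil w))
  refine ⟨A, hA1, hA2, ?_⟩
  have hA3' : ((m : ℝ) + 1) * ((U.filter fun i => v i (A i) < t).card : ℝ) ≤ U.card := by
    exact_mod_cast hA3
  calc ((U.filter fun i => v i (A i) < t).card : ℝ) * w
      ≤ (U.filter fun i => v i (A i) < t).card * (U.card * (m + 1)) := by gcongr
    _ = U.card * ((m + 1) * (U.filter fun i => v i (A i) < t).card) := by ring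
    _ ≤ U.card * U.card := by gcongr
    _ = _ := by ring

/-- With `c * n` pieces per agent in every colour class, serving the remaining agents from one
class after another leaves at most `n / c ^ (2 ^ s - 1)` agents after `s` rounds. -/
theorem exists_allocation_after_rounds {v : ι → Finset M → ℝ} (hmono : ∀ i, Monotone (v i))
    (hsub : ∀ i, IsSubadditive (v i)) {t : ℝ} (U : Finset ι) (X : Finset M) {R : ℕ}
    (χ : M → Fin R) {c : ℝ} (hc : 0 < c)
    (hP : ∀ i ∈ U, ∀ r, ∃ (N : ℕ) (P : Fin N → Finset M),
      (Pairwise fun l l' => Disjoint (P l) (P l')) ∧ (∀ l, P l ⊆ X.filter fun e => χ e = r) ∧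
      (∀ l, 2 * t ≤ v i (P l)) ∧ c * U.card ≤ N) (s : ℕ) (hs : s ≤ R) :
    ∃ A : ι → Finset M, (Pairwise fun i i' => Disjoint (A i) (A i')) ∧
      (∀ i, A i ⊆ X.filter fun e => (χ e : ℕ) < s) ∧
      ((U.filter fun i => v i (A i) < t).card : ℝ) * c ^ (2 ^ s - 1) ≤ U.card := by
  rcases U.eq_empty_or_nonempty with rfl | hU
  · exact ⟨fun _ => ∅, fun _ _ _ => Finset.disjoint_empty_left _, fun _ => Finset.empty_subset _,
      by simp⟩
  have hn : (0 : ℝ) < U.card := by exact_mod_cast hU.card_pos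
  induction s with
  | zero =>
    refine ⟨fun _ => ∅, fun _ _ _ => Finset.disjoint_empty_left _, fun _ => Finset.empty_subset _,
      ?_⟩
    simpa using Finset.card_filter_le U fun i => v i ∅ < t
  | succ s ih =>
    obtain ⟨A, hA1, hA2, hA3⟩ := ih (by omega)
    set U' := U.filter fun i => v i (A i) < t with hU'
    obtain ⟨A', hA1', hA2', hA3'⟩ := exists_allocation_unserved_mul_le hmono hsub (t := t) U'
      (X.filter fun e => χ e = ⟨s, hs⟩) (mul_pos hc hn)
      fun i hi => hP i (Finset.mem_filter.mp hi).1 ⟨s, hs⟩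
    have hcross : ∀ i i', Disjoint (A i) (A' i') := by
      intro i i'
      rw [Finset.disjoint_left]
      intro e he he'
      have h1 := (Finset.mem_filter.mp (hA2 i he)).2
      have h2 := (Finset.mem_filter.mp (hA2' i' he')).2
      rw [h2] at h1
      exact lt_irrefl _ h1
    refine ⟨fun i => A i ∪ A' i, ?_, ?_, ?_⟩
    · intro i i' hne
      simp only [Finset.disjoint_union_left, Finset.disjoint_union_right]
      exact ⟨⟨hA1 hne, (hcross i' i).symm⟩, hcross i i', hA1' hne⟩
    · intro i e he
      rw [Finset.mem_filter]
      rcases Finset.mem_union.mp he with h | h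
      · have := Finset.mem_filter.mp (hA2 i h)
        exact ⟨this.1, by omega⟩
      · have := Finset.mem_filter.mp (hA2' i h)
        exact ⟨this.1, by rw [this.2]; exact Nat.lt_succ_self s⟩
    · have hle : ((U.filter fun i => v i (A i ∪ A' i) < t).card : ℝ)
          ≤ (U'.filter fun i => v i (A' i) < t).card := by
        refine Nat.cast_le.mpr (Finset.card_le_card fun i hi => ?_)
        rw [Finset.mem_filter] at hi
        rw [Finset.mem_filter, hU', Finset.mem_filter]
        exact ⟨⟨hi.1, (hmono i Finset.subset_union_left).trans_lt hi.2⟩,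
          (hmono i Finset.subset_union_right).trans_lt hi.2⟩
      have hexp : 2 ^ (s + 1) - 1 = 1 + 2 * (2 ^ s - 1) := by
        have := Nat.one_le_two_pow (n := s)
        rw [pow_succ]
        omega
      have hpos : 0 < c ^ (2 ^ s - 1) := pow_pos hc _
      rw [hexp, pow_add, pow_one, pow_mul']
      have h1 : ((U.filter fun i => v i (A i ∪ A' i) < t).card : ℝ) * (c * U.card)
          ≤ (U'.card : ℝ) ^ 2 := le_trans (by gcongr) hA3'
      have h2 : ((U'.card : ℝ) * c ^ (2 ^ s - 1)) ^ 2 ≤ (U.card : ℝ) ^ 2 := by gcongr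
      refine le_of_mul_le_mul_right ?_ hn
      calc ((U.filter fun i => v i (A i ∪ A' i) < t).card : ℝ) *
            (c * (c ^ (2 ^ s - 1)) ^ 2) * U.card
          = (U.filter fun i => v i (A i ∪ A' i) < t).card * (c * U.card)
              * (c ^ (2 ^ s - 1)) ^ 2 := by ring
        _ ≤ (U'.card : ℝ) ^ 2 * (c ^ (2 ^ s - 1)) ^ 2 := by gcongr
        _ = ((U'.card : ℝ) * c ^ (2 ^ s - 1)) ^ 2 := by ring
        _ ≤ (U.card : ℝ) ^ 2 := h2
        _ = U.card * U.card := by ring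

/-- All agents can be served in `R` rounds, provided a balanced colouring with `R` colours exists
and the colour classes contain enough pieces. -/
theorem exists_allocation_of_tail_lt {v : ι → Finset M → ℝ} (hmono : ∀ i, Monotone (v i))
    (hsub : ∀ i, IsSubadditive (v i)) {t : ℝ} (ht : 0 < t) (U : Finset ι) (X : Finset M)
    (hsmall : ∀ i ∈ U, ∀ T ⊆ X, T.card ≤ 1 → v i T < t)
    (hB : ∀ i ∈ U, ∃ B : Fin U.card → Finset M, (Pairwise fun j j' => Disjoint (B j) (B j')) ∧
      (∀ j, B j ⊆ X) ∧ ∀ j, 1 ≤ v i (B j))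
    {R : ℕ} (hR : 0 < R) {c : ℝ} (hc : 0 < c) (hcR : 2 * R * (3 * c + 2) * t ≤ 1)
    (hcn : (U.card : ℝ) < c ^ (2 ^ R - 1))
    (htail : (U.card : ℝ) * R *
      (Real.exp (U.card / (2 * R)) * (1 - (1 - Real.exp (-1)) / R) ^ U.card) < 1) :
    ∃ A : ι → Finset M, (Pairwise fun i i' => Disjoint (A i) (A i')) ∧ (∀ i, A i ⊆ X) ∧
      ∀ i ∈ U, t ≤ v i (A i) := by
  have hB' : ∀ i, ∃ B : Fin U.card → Finset M, i ∈ U →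
      (Pairwise fun j j' => Disjoint (B j) (B j')) ∧ (∀ j, B j ⊆ X) ∧ ∀ j, 1 ≤ v i (B j) := by
    intro i
    by_cases hi : i ∈ U
    · obtain ⟨B, h⟩ := hB i hi
      exact ⟨B, fun _ => h⟩
    · exact ⟨fun _ => ∅, fun h => absurd h hi⟩
  choose B hB' using hB'
  obtain ⟨χ, hχ⟩ := exists_balanced_coloring U hmono hsub hR B (fun i hi => (hB' i hi).1)
    (fun i hi => (hB' i hi).2.2) htail
  have hRr : (0 : ℝ) < R := by exact_mod_cast hR
  obtain ⟨A, hA1, hA2, hA3⟩ := exists_allocation_after_rounds hmono hsub (t := t) U X χ hc (by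
    intro i hi r
    obtain ⟨hd, hBX, -⟩ := hB' i hi
    have hCX : ∀ j, ((B i j).filter fun e => χ e = r) ⊆ X.filter fun e => χ e = r :=
      fun j => Finset.filter_subset_filter _ (hBX j)
    obtain ⟨N, P, h1, h2, h3, h4⟩ := exists_pieces_of_family (hmono i) (hsub i) (t := t)
      (fun j => (B i j).filter fun e => χ e = r)
      (fun j j' hne => Finset.disjoint_filter_filter (hd hne))
      (fun j T hT => hsmall i hi T (hT.trans ((hCX j).trans (Finset.filter_subset _ _))))
    refine ⟨N, P, h1, fun l => ?_, h3, ?_⟩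
    · obtain ⟨j, hj⟩ := h2 l
      exact hj.trans (hCX j)
    · have h5 : (U.card : ℝ) / (2 * R) ≤ ∑ j, v i ((B i j).filter fun e => χ e = r) :=
        (hχ i hi r).trans (Finset.sum_le_sum fun j _ => min_le_right _ _)
      have h6 : (3 * c + 2) * t * U.card ≤ (U.card : ℝ) / (2 * R) := by
        rw [le_div_iff₀ (by positivity)]
        have := mul_le_mul_of_nonneg_right hcR (Nat.cast_nonneg (α := ℝ) U.card)
        linarith
      have h7 : 3 * t * (c * U.card) ≤ 3 * t * N := by linarith
      exact le_of_mul_le_mul_left h7 (by positivity)) R le_rfl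
  refine ⟨A, hA1, fun i => (hA2 i).trans (Finset.filter_subset _ _), ?_⟩
  have hzero : (U.filter fun i => v i (A i) < t).card = 0 := by
    by_contra hne
    have h1 : (1 : ℝ) ≤ (U.filter fun i => v i (A i) < t).card := by
      exact_mod_cast Nat.one_le_iff_ne_zero.mpr hne
    have h2 := mul_le_mul_of_nonneg_right h1 (pow_pos hc (2 ^ R - 1)).le
    linarith
  intro i hi
  by_contra! hlt
  rw [Finset.card_eq_zero] at hzero
  have : i ∈ U.filter fun i => v i (A i) < t := Finset.mem_filter.mpr ⟨hi, hlt⟩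
  simp [hzero] at this

end Rounds

/-! ### Bag filling -/

/-- If every agent values all items at `(2 * k - 1) * t`, where `k` is the number of agents, then
repeatedly handing out a minimal set worth `t` to somebody serves everybody. -/
theorem exists_allocation_of_total_value {ι M : Type*} [DecidableEq ι] [DecidableEq M]
    {v : ι → Finset M → ℝ} (hmono : ∀ i, Monotone (v i)) (hsub : ∀ i, IsSubadditive (v i))
    {t : ℝ} (U : Finset ι) (X : Finset M)
    (hsmall : ∀ i ∈ U, ∀ T ⊆ X, T.card ≤ 1 → v i T < t)
    (hval : ∀ i ∈ U, (2 * U.card - 1) * t ≤ v i X) :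
    ∃ A : ι → Finset M, (Pairwise fun i i' => Disjoint (A i) (A i')) ∧ (∀ i, A i ⊆ X) ∧
      ∀ i ∈ U, t ≤ v i (A i) := by
  induction U using Finset.strongInduction generalizing X with
  | H U ih =>
    rcases U.eq_empty_or_nonempty with rfl | ⟨i₀, hi₀⟩
    · exact ⟨fun _ => ∅, fun _ _ _ => Finset.disjoint_empty_left _,
        fun _ => Finset.empty_subset _, by simp⟩
    have ht : 0 < t := ((hsub i₀).nonneg (hmono i₀) ∅).trans_lt
      (hsmall i₀ hi₀ ∅ (Finset.empty_subset _) (by simp))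
    have hk : (1 : ℝ) ≤ U.card := by exact_mod_cast Finset.card_pos.mpr ⟨i₀, hi₀⟩
    obtain ⟨S, hS, hmin⟩ := Finset.exists_min_image
      (X.powerset.filter fun S => ∃ i ∈ U, t ≤ v i S) Finset.card
      ⟨X, by
        rw [Finset.mem_filter, Finset.mem_powerset]
        refine ⟨subset_rfl, i₀, hi₀, le_trans ?_ (hval i₀ hi₀)⟩
        nlinarith⟩
    rw [Finset.mem_filter, Finset.mem_powerset] at hS
    obtain ⟨hSX, i, hi, hiS⟩ := hS
    have hSne : S.Nonempty := by
      rw [Finset.nonempty_iff_ne_empty]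
      rintro rfl
      exact absurd hiS (not_le.mpr (hsmall i hi ∅ (Finset.empty_subset _) (by simp)))
    obtain ⟨A, hA1, hA2, hA3⟩ := ih (U.erase i) (Finset.erase_ssubset hi) (X \ S)
      (fun i' hi' T hT => hsmall i' (Finset.mem_of_mem_erase hi') T
        (hT.trans Finset.sdiff_subset)) (by
        intro i' hi'
        have hi'U := Finset.mem_of_mem_erase hi'
        have h1 : v i' S < t + t := by
          refine lt_add_of_forall_erase_lt (hsub i') hSne
            (fun e he => hsmall i' hi'U {e} (by simpa using hSX he) (by simp)) fun e he => ?_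
          by_contra! hcon
          have := hmin (S.erase e) (by
            rw [Finset.mem_filter, Finset.mem_powerset]
            exact ⟨(Finset.erase_subset _ _).trans hSX, i', hi'U, hcon⟩)
          exact absurd this (not_le.mpr (Finset.card_erase_lt_of_mem he))
        have h2 := hsub i' S (X \ S)
        rw [Finset.union_sdiff_of_subset hSX] at h2
        have h3 := hval i' hi'U
        rw [Finset.cast_card_erase_of_mem hi]
        linarith)
    have hSA : ∀ i', Disjoint S (A i') := fun i' =>
      Finset.disjoint_of_subset_right (hA2 i') Finset.disjoint_sdiff
    refine ⟨Function.update A i S, ?_, ?_, ?_⟩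
    · intro j j' hne
      by_cases hj : j = i
      · subst hj
        simpa [Function.update_of_ne hne.symm] using hSA j'
      · by_cases hj' : j' = i
        · subst hj'
          simpa [Function.update_of_ne hj] using (hSA j).symm
        · simpa [Function.update_of_ne hj, Function.update_of_ne hj'] using hA1 hne
    · intro j
      by_cases hj : j = i
      · subst hj; simpa using hSX
      · simpa [Function.update_of_ne hj] using (hA2 j).trans Finset.sdiff_subset
    · intro j hjU
      by_cases hj : j = i
      · subst hj; simpa using hiS
      · simpa [Function.update_of_ne hj] using hA3 j (Finset.mem_erase.mpr ⟨hj, hjU⟩)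

/-! ### Numerical estimates -/

theorem le_mul_logb_of_pow_le {n a b : ℕ} (h : 2 ^ a ≤ n ^ b) :
    (a : ℝ) ≤ b * Real.logb 2 n := by
  have h1 : (2 : ℝ) ^ a ≤ (n : ℝ) ^ b := by exact_mod_cast h
  have h2 := Real.logb_le_logb_of_le one_lt_two (by positivity) h1
  rwa [Real.logb_pow, Real.logb_pow, Real.logb_self_eq_one one_lt_two, mul_one] at h2

theorem two_mul_sub_one_le_logb {n : ℕ} (h2 : 2 ≤ n) (h36 : n ≤ 36) :
    2 * (n : ℝ) - 1 ≤ 14 * Real.logb 2 n := by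
  rcases le_or_gt n 7 with h | h
  · have h1 : (n : ℝ) ≤ 7 := by exact_mod_cast h
    have := le_mul_logb_of_pow_le (n := n) (a := 1) (b := 1) (by simpa using h2)
    norm_num at this
    linarith
  rcases le_or_gt n 21 with h | h
  · have h1 : (n : ℝ) ≤ 21 := by exact_mod_cast h
    have := le_mul_logb_of_pow_le (n := n) (a := 3) (b := 1) (by norm_num; omega)
    norm_num at this
    linarith
  rcases le_or_gt n 31 with h' | h'
  · have h1 : (n : ℝ) ≤ 31 := by exact_mod_cast h'
    have := le_mul_logb_of_pow_le (n := n) (a := 22) (b := 5)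
      (le_trans (by norm_num) (Nat.pow_le_pow_left (Nat.succ_le_of_lt h) 5))
    norm_num at this
    linarith
  rcases le_or_gt n 35 with h'' | h''
  · have h1 : (n : ℝ) ≤ 35 := by exact_mod_cast h''
    have := le_mul_logb_of_pow_le (n := n) (a := 5) (b := 1) (by norm_num; omega)
    norm_num at this
    linarith
  · have h1 : (n : ℝ) ≤ 36 := by exact_mod_cast h36
    have := le_mul_logb_of_pow_le (n := n) (a := 51) (b := 10)
      (le_trans (by norm_num) (Nat.pow_le_pow_left (Nat.succ_le_of_lt h'') 10))
    norm_num at this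
    linarith

/-- The Chernoff bounds for two colours sum to less than one as soon as there are `37` agents. -/
theorem tail_two_lt_one {n : ℕ} (hn : 37 ≤ n) :
    (n : ℝ) * (2 : ℕ) * (Real.exp (n / (2 * (2 : ℕ))) *
      (1 - (1 - Real.exp (-1)) / (2 : ℕ)) ^ n) < 1 := by
  have h1 : Real.exp (1 / 4) ≤ 1.2841 := by
    have h : Real.exp (1 / 4) ^ 4 = Real.exp 1 := by
      rw [← Real.exp_nat_mul]; norm_num
    have h' := Real.exp_one_lt_d9
    refine le_of_pow_le_pow_left₀ (n := 4) (by norm_num) (by norm_num) ?_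
    rw [h]
    norm_num at h' ⊢
    linarith
  have h2 := Real.exp_neg_one_lt_d9
  have h2' := Real.exp_pos (-1)
  have h3 : Real.exp (1 / 4) * (1 - (1 - Real.exp (-1)) / 2) ≤ 0.8783 := by
    calc Real.exp (1 / 4) * (1 - (1 - Real.exp (-1)) / 2)
        ≤ 1.2841 * (1 - (1 - 0.3678794412) / 2) := by
          refine mul_le_mul h1 (by linarith) (by linarith) (by norm_num)
      _ ≤ 0.8783 := by norm_num
  have h4 : Real.exp (n / (2 * (2 : ℕ))) * (1 - (1 - Real.exp (-1)) / (2 : ℕ)) ^ n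
      ≤ 0.8783 ^ n := by
    have : Real.exp ((n : ℝ) / (2 * (2 : ℕ))) = Real.exp (1 / 4) ^ n := by
      rw [← Real.exp_nat_mul]
      congr 1
      push_cast
      ring
    rw [this, ← mul_pow]
    exact pow_le_pow_left₀ (mul_nonneg (Real.exp_pos _).le (by push_cast; linarith))
      (by exact_mod_cast h3) n
  have h5 : ∀ n : ℕ, 37 ≤ n → (n : ℝ) * 2 * 0.8783 ^ n < 1 := by
    intro n hn
    induction n, hn using Nat.le_induction with
    | base => norm_num
    | succ n hn ih =>
      have hn' : (37 : ℝ) ≤ n := by exact_mod_cast hn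
      have hp : (0 : ℝ) < 0.8783 ^ n := by positivity
      calc ((n + 1 : ℕ) : ℝ) * 2 * 0.8783 ^ (n + 1)
          = (0.8783 * (n + 1)) * (2 * 0.8783 ^ n) := by push_cast; ring
        _ ≤ n * (2 * 0.8783 ^ n) := by
            gcongr
            linarith
        _ = n * 2 * 0.8783 ^ n := by ring
        _ < 1 := ih
  refine lt_of_le_of_lt ?_ (h5 n hn)
  push_cast at h4 ⊢
  gcongr

theorem pow_five_le_eight_pow {R : ℕ} (hR : 3 ≤ R) : R ^ 5 ≤ 8 ^ R := by
  induction R, hR using Nat.le_induction with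
  | base => norm_num
  | succ R hR ih =>
    have h := Nat.pow_le_pow_left (show 3 * (R + 1) ≤ 4 * R by omega) 5
    rw [mul_pow, mul_pow] at h
    rw [pow_succ 8]
    norm_num at h
    omega

/-- The Chernoff bounds for `R ≥ 3` colours sum to less than one for `8 ^ R` or more agents. -/
theorem tail_lt_one {n R : ℕ} (hR : 3 ≤ R) (hn : 8 ^ R ≤ n) :
    (n : ℝ) * R * (Real.exp (n / (2 * R)) * (1 - (1 - Real.exp (-1)) / R) ^ n) < 1 := by
  have hR3 : (3 : ℝ) ≤ R := by exact_mod_cast hR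
  have hn512 : (512 : ℝ) ≤ n := by
    have : 8 ^ 3 ≤ n := (Nat.pow_le_pow_right (by norm_num) hR).trans hn
    exact_mod_cast this
  have hR5 : (R : ℝ) ^ 5 ≤ n := by exact_mod_cast (pow_five_le_eight_pow hR).trans hn
  have he := Real.exp_neg_one_lt_d9
  have he' := Real.exp_pos (-1)
  set y : ℝ := 0.132 * n / R with hy
  have hy0 : 0 ≤ y := by positivity
  have h1 : Real.exp (n / (2 * R)) * (1 - (1 - Real.exp (-1)) / R) ^ n ≤ Real.exp (-y) := by
    have h2 : 1 - (1 - Real.exp (-1)) / R ≤ Real.exp (-((1 - Real.exp (-1)) / R)) := by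
      have := Real.add_one_le_exp (-((1 - Real.exp (-1)) / (R : ℝ)))
      linarith
    have h3 : 0 ≤ 1 - (1 - Real.exp (-1)) / R := by
      have : (1 - Real.exp (-1)) / R ≤ 1 := by
        rw [div_le_one (by positivity)]
        linarith
      linarith
    calc _ ≤ Real.exp (n / (2 * R)) * Real.exp (-((1 - Real.exp (-1)) / R)) ^ n := by gcongr
      _ = Real.exp (-((1 / 2 - Real.exp (-1)) * n / R)) := by
        rw [← Real.exp_nat_mul, ← Real.exp_add]
        congr 1
        field_simp
        ring
      _ ≤ Real.exp (-y) := by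
        rw [Real.exp_le_exp, hy, neg_le_neg_iff]
        gcongr
        linarith
  have h2 : (n : ℝ) * R < Real.exp y := by
    refine lt_of_lt_of_le ?_ (Real.pow_div_factorial_le_exp y hy0 4)
    have h3 : y ^ 4 / (Nat.factorial 4 : ℝ) = 0.132 ^ 4 * n ^ 4 / (24 * R ^ 4) := by
      rw [hy, show (Nat.factorial 4 : ℝ) = 24 by norm_num [Nat.factorial]]
      field_simp
    rw [h3, lt_div_iff₀ (by positivity)]
    have h4 : (512 : ℝ) ^ 2 ≤ (n : ℝ) ^ 2 := by gcongr
    calc (n : ℝ) * R * (24 * (R : ℝ) ^ 4) = 24 * n * (R : ℝ) ^ 5 := by ring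
      _ ≤ 24 * (n : ℝ) * n := by gcongr
      _ = 24 * (n : ℝ) ^ 2 := by ring
      _ < (0.132 ^ 4 * 512 ^ 2) * (n : ℝ) ^ 2 := by
        refine mul_lt_mul_of_pos_right (by norm_num) (by positivity)
      _ ≤ (0.132 ^ 4 * (n : ℝ) ^ 2) * (n : ℝ) ^ 2 := by gcongr
      _ = 0.132 ^ 4 * (n : ℝ) ^ 4 := by ring
  calc _ ≤ (n : ℝ) * R * Real.exp (-y) := by gcongr
    _ < Real.exp y * Real.exp (-y) := by
      have := Real.exp_pos (-y)
      gcongr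
    _ = 1 := by rw [← Real.exp_add]; simp

theorem eight_pow_le_six_pow {R : ℕ} (hR : 3 ≤ R) : 8 ^ (R + 1) ≤ 6 ^ (2 ^ R - 1) := by
  induction R, hR using Nat.le_induction with
  | base => norm_num
  | succ R hR ih =>
    have h1 : 2 ^ R - 1 + 2 ≤ 2 ^ (R + 1) - 1 := by
      have := Nat.pow_le_pow_right (n := 2) (by norm_num) hR
      rw [pow_succ]
      omega
    calc 8 ^ (R + 1 + 1) = 8 ^ (R + 1) * 8 := pow_succ _ _
      _ ≤ 6 ^ (2 ^ R - 1) * 6 ^ 2 := Nat.mul_le_mul ih (by norm_num)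
      _ = 6 ^ (2 ^ R - 1 + 2) := (pow_add _ _ _).symm
      _ ≤ _ := Nat.pow_le_pow_right (by norm_num) h1

/-- The number of colours `R` and the density of pieces `c` with which `R` rounds serve `n ≥ 37`
agents. The condition on `2 * R * (3 * c + 2)` guarantees `c * n` pieces per colour class, and the
condition on `c ^ (2 ^ R - 1)` that fewer than one agent is left after the last round. -/
theorem exists_round_parameters {n : ℕ} (hn : 37 ≤ n) :
    ∃ (R : ℕ) (c : ℝ), 0 < R ∧ 0 < c ∧ 2 * R * (3 * c + 2) ≤ 14 * Real.logb 2 n ∧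
      (n : ℝ) < c ^ (2 ^ R - 1) ∧
      (n : ℝ) * R * (Real.exp (n / (2 * R)) * (1 - (1 - Real.exp (-1)) / R) ^ n) < 1 := by
  -- Two rounds suffice below `512`; on each range `c` is chosen below the largest density that the
  -- lower bound on `logb 2 n` permits, and large enough that `c ^ 3` exceeds `n`.
  rcases lt_or_ge n 128 with h | h
  · refine ⟨2, 5.1, by norm_num, by norm_num, ?_, ?_, tail_two_lt_one hn⟩
    · have := le_mul_logb_of_pow_le (n := n) (a := 26) (b := 5)
        (le_trans (by norm_num) (Nat.pow_le_pow_left hn 5))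
      norm_num at this ⊢
      linarith
    · have : (n : ℝ) < 128 := by exact_mod_cast h
      exact this.trans (by norm_num)
  rcases lt_or_ge n 256 with h' | h'
  · refine ⟨2, 7, by norm_num, by norm_num, ?_, ?_, tail_two_lt_one hn⟩
    · have := le_mul_logb_of_pow_le (n := n) (a := 7) (b := 1) (by simpa using h)
      norm_num at this ⊢
      linarith
    · have : (n : ℝ) < 256 := by exact_mod_cast h'
      exact this.trans (by norm_num)
  rcases lt_or_ge n 512 with h'' | h''
  · refine ⟨2, 8.5, by norm_num, by norm_num, ?_, ?_, tail_two_lt_one hn⟩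
    · have := le_mul_logb_of_pow_le (n := n) (a := 8) (b := 1) (by simpa using h')
      norm_num at this ⊢
      linarith
    · have : (n : ℝ) < 512 := by exact_mod_cast h''
      exact this.trans (by norm_num)
  · have hR : 3 ≤ Nat.log 8 n := Nat.le_log_of_pow_le (by norm_num) h''
    have hle : 8 ^ Nat.log 8 n ≤ n := Nat.pow_log_le_self 8 (by omega)
    refine ⟨Nat.log 8 n, 6, by omega, by norm_num, ?_, ?_, tail_lt_one hR hle⟩
    · have := le_mul_logb_of_pow_le (n := n) (a := 3 * Nat.log 8 n) (b := 1)
        (by rw [pow_mul, pow_one]; exact hle)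
      push_cast at this
      have h3 : (0 : ℝ) ≤ Nat.log 8 n := Nat.cast_nonneg _
      linarith
    · have := (Nat.lt_pow_succ_log_self (b := 8) (by norm_num) n).trans_le
        (eight_pow_le_six_pow hR)
      exact_mod_cast this

/-! ### The allocation -/

section Main

variable {ι M : Type*} [DecidableEq ι] [Fintype M] [DecidableEq M]

theorem exists_allocation_of_small_items {v : ι → Finset M → ℝ} (hmono : ∀ i, Monotone (v i))
    (hsub : ∀ i, IsSubadditive (v i)) {t : ℝ} (ht1 : t ≤ 1) (U : Finset ι) (X : Finset M)
    (hlog : 14 * Real.logb 2 U.card * t ≤ 1)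
    (hsmall : ∀ i ∈ U, ∀ T ⊆ X, T.card ≤ 1 → v i T < t)
    (hB : ∀ i ∈ U, ∃ B : Fin U.card → Finset M, (Pairwise fun j j' => Disjoint (B j) (B j')) ∧
      (∀ j, B j ⊆ X) ∧ ∀ j, 1 ≤ v i (B j)) :
    ∃ A : ι → Finset M, (Pairwise fun i i' => Disjoint (A i) (A i')) ∧ (∀ i, A i ⊆ X) ∧
      ∀ i ∈ U, t ≤ v i (A i) := by
  rcases U.eq_empty_or_nonempty with rfl | ⟨i₀, hi₀⟩
  · exact ⟨fun _ => ∅, fun _ _ _ => Finset.disjoint_empty_left _, fun _ => Finset.empty_subset _,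
      by simp⟩
  have ht : 0 < t := ((hsub i₀).nonneg (hmono i₀) ∅).trans_lt
    (hsmall i₀ hi₀ ∅ (Finset.empty_subset _) (by simp))
  have hpos : 0 < U.card := Finset.card_pos.mpr ⟨i₀, hi₀⟩
  rcases le_or_gt U.card 36 with h36 | h37
  · refine exists_allocation_of_total_value hmono hsub U X hsmall fun i hi => ?_
    obtain ⟨B, -, hBX, hB1⟩ := hB i hi
    refine le_trans ?_ ((hB1 ⟨0, hpos⟩).trans (hmono i (hBX _)))
    rcases (Nat.succ_le_of_lt hpos).eq_or_lt with h1 | h2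
    · rw [← h1]
      norm_num
      exact ht1
    · exact (mul_le_mul_of_nonneg_right (two_mul_sub_one_le_logb h2 h36) ht.le).trans hlog
  · obtain ⟨R, c, hR, hc, hcR, hcn, htail⟩ := exists_round_parameters (Nat.succ_le_of_lt h37)
    exact exists_allocation_of_tail_lt hmono hsub ht U X hsmall hB hR hc
      ((mul_le_mul_of_nonneg_right hcR ht.le).trans hlog) hcn htail

/-- An agent who values a single item (or nothing at all) at `t` can be served by that item alone;
this destroys at most one bundle of every other agent. -/
theorem exists_allocation_of_bundles {v : ι → Finset M → ℝ} (hmono : ∀ i, Monotone (v i))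
    (hsub : ∀ i, IsSubadditive (v i)) {t : ℝ} (ht0 : 0 ≤ t) (ht1 : t ≤ 1) (k : ℕ)
    (hlog : 14 * Real.logb 2 k * t ≤ 1) (U : Finset ι) (hU : U.card = k) (X : Finset M)
    (hB : ∀ i ∈ U, ∃ B : Fin k → Finset M, (Pairwise fun j j' => Disjoint (B j) (B j')) ∧
      (∀ j, B j ⊆ X) ∧ ∀ j, 1 ≤ v i (B j)) :
    ∃ A : ι → Finset M, (Pairwise fun i i' => Disjoint (A i) (A i')) ∧ (∀ i, A i ⊆ X) ∧
      ∀ i ∈ U, t ≤ v i (A i) := by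
  induction k generalizing U X with
  | zero =>
    rw [Finset.card_eq_zero] at hU
    subst hU
    exact ⟨fun _ => ∅, fun _ _ _ => Finset.disjoint_empty_left _, fun _ => Finset.empty_subset _,
      by simp⟩
  | succ k ih =>
    by_cases hbig : ∃ i ∈ U, ∃ T ⊆ X, T.card ≤ 1 ∧ t ≤ v i T
    · obtain ⟨i, hi, T, hTX, hT1, hTv⟩ := hbig
      have hlog' : 14 * Real.logb 2 k * t ≤ 1 := by
        rcases Nat.eq_zero_or_pos k with rfl | hk
        · simp
        · refine le_trans ?_ hlog
          have hk' : (0 : ℝ) < k := by exact_mod_cast hk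
          have : Real.logb 2 k ≤ Real.logb 2 ((k + 1 : ℕ) : ℝ) :=
            Real.logb_le_logb_of_le one_lt_two hk' (by push_cast; linarith)
          gcongr
      obtain ⟨A, hA1, hA2, hA3⟩ := ih hlog' (U.erase i)
        (by rw [Finset.card_erase_of_mem hi, hU, Nat.add_sub_cancel]) (X \ T) (by
          intro i' hi'
          obtain ⟨B, hd, hBX, hB1⟩ := hB i' (Finset.mem_of_mem_erase hi')
          -- `j₀` is the bundle met by `T`, if any.
          obtain ⟨j₀, hj₀⟩ : ∃ j₀, ∀ j, j ≠ j₀ → Disjoint (B j) T := by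
            by_cases hmeet : ∃ j₀, ¬ Disjoint (B j₀) T
            · obtain ⟨j₀, hj₀⟩ := hmeet
              obtain ⟨e, he, heT⟩ := Finset.not_disjoint_iff.mp hj₀
              refine ⟨j₀, fun j hj => Finset.disjoint_left.mpr fun e' he' he'T => ?_⟩
              rw [Finset.card_le_one.mp hT1 e' he'T e heT] at he'
              exact Finset.disjoint_left.mp (hd hj) he' he
            · push Not at hmeet
              exact ⟨0, fun j _ => hmeet j⟩
          exact ⟨fun j => B (j₀.succAbove j),
            fun j j' hne => hd fun h => hne (Fin.succAbove_right_injective h),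
            fun j => Finset.subset_sdiff.mpr ⟨hBX _, hj₀ _ (Fin.succAbove_ne j₀ j)⟩,
            fun j => hB1 _⟩)
      have hTA : ∀ i', Disjoint T (A i') := fun i' =>
        Finset.disjoint_of_subset_right (hA2 i') Finset.disjoint_sdiff
      refine ⟨Function.update A i T, ?_, ?_, ?_⟩
      · intro j j' hne
        by_cases hj : j = i
        · subst hj
          simpa [Function.update_of_ne hne.symm] using hTA j'
        · by_cases hj' : j' = i
          · subst hj'
            simpa [Function.update_of_ne hj] using (hTA j).symm
          · simpa [Function.update_of_ne hj, Function.update_of_ne hj'] using hA1 hne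
      · intro j
        by_cases hj : j = i
        · subst hj; simpa using hTX
        · simpa [Function.update_of_ne hj] using (hA2 j).trans Finset.sdiff_subset
      · intro j hjU
        by_cases hj : j = i
        · subst hj; simpa using hTv
        · simpa [Function.update_of_ne hj] using hA3 j (Finset.mem_erase.mpr ⟨hj, hjU⟩)
    · push Not at hbig
      rw [← hU] at hlog hB
      exact exists_allocation_of_small_items hmono hsub ht1 U X hlog hbig hB

end Main

theorem disjoint_bundle {M : Type*} [Fintype M] {n : ℕ} (a : M → Fin n) :
    Pairwise fun j j' => Disjoint (bundle a j) (bundle a j') := by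
  intro j j' hne
  rw [Finset.disjoint_left]
  intro e he he'
  exact hne ((Finset.mem_filter.mp he).2.symm.trans (Finset.mem_filter.mp he').2)

theorem exists_mms_le_bundle {M : Type*} [Fintype M] {n : ℕ} (hn : 0 < n) (v : Finset M → ℝ) :
    ∃ a : M → Fin n, ∀ j, mms n v ≤ v (bundle a j) := by
  have : Nonempty (Fin n) := ⟨⟨0, hn⟩⟩
  classical
  obtain ⟨a, ha⟩ := exists_eq_ciSup_of_finite (f := fun a : M → Fin n => ⨅ j, v (bundle a j))
  refine ⟨a, fun j => ?_⟩
  rw [mms, ← ha]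
  exact ciInf_le (Set.finite_range _).bddBelow j

end FairAllocation


open FairAllocation in
theorem theorem1 {M : Type*} [Fintype M] [DecidableEq M] (n : ℕ) (hn : 2 ≤ n)
    (v : Fin n → Finset M → ℝ)
    (hmono : ∀ i, Monotone (v i))
    (hsub : ∀ i, FairAllocation.IsSubadditive (v i)) :
    ∃ a : M → Fin n, ∀ i : Fin n,
      1 / (14 * Real.logb 2 n) * FairAllocation.mms n (v i)
        ≤ v i (FairAllocation.bundle a i) := by
  have hL : 1 ≤ Real.logb 2 n := by
    have := le_mul_logb_of_pow_le (n := n) (a := 1) (b := 1) (by simpa using hn)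
    simpa using this
  set t : ℝ := 1 / (14 * Real.logb 2 n) with ht
  have ht0 : 0 ≤ t := by positivity
  have ht1 : t ≤ 1 := by
    rw [ht, div_le_one (by linarith)]
    linarith
  have hlog : 14 * Real.logb 2 n * t ≤ 1 := (mul_one_div_cancel (by linarith)).le
  -- Valuations are normalised to maximin share one; an agent whose share is zero needs nothing
  -- and is given a constant valuation.
  let w : Fin n → Finset M → ℝ := fun i S => if 0 < mms n (v i) then v i S / mms n (v i) else 1
  have hwmono : ∀ i, Monotone (w i) := by
    intro i S T hST
    simp only [w]
    split_ifs with h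
    · exact div_le_div_of_nonneg_right (hmono i hST) h.le
    · exact le_rfl
  have hwsub : ∀ i, IsSubadditive (w i) := by
    intro i S T
    simp only [w]
    split_ifs with h
    · rw [← add_div]
      exact div_le_div_of_nonneg_right (hsub i S T) h.le
    · norm_num
  obtain ⟨A, hA1, -, hA3⟩ := exists_allocation_of_bundles hwmono hwsub ht0 ht1 n hlog
    Finset.univ (by simp) Finset.univ (by
      intro i _
      obtain ⟨a, ha⟩ := exists_mms_le_bundle (by omega : 0 < n) (v i)
      refine ⟨bundle a, disjoint_bundle a, fun j => Finset.subset_univ _, fun j => ?_⟩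
      simp only [w]
      split_ifs with h
      · rw [le_div_iff₀ h, one_mul]
        exact ha j
      · exact le_rfl)
  have hex : ∀ e : M, ∃ i : Fin n, ∀ i', e ∈ A i' → i' = i := by
    intro e
    by_cases h : ∃ i, e ∈ A i
    · obtain ⟨i, hi⟩ := h
      refine ⟨i, fun i' hi' => ?_⟩
      by_contra hne
      exact Finset.disjoint_left.mp (hA1 hne) hi' hi
    · exact ⟨⟨0, by omega⟩, fun i' hi' => absurd ⟨i', hi'⟩ h⟩
  choose a ha using hex
  refine ⟨a, fun i => ?_⟩
  by_cases h : 0 < mms n (v i)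
  · have h1 : A i ⊆ bundle a i := fun e he =>
      Finset.mem_filter.mpr ⟨Finset.mem_univ _, (ha e i he).symm⟩
    have h2 := hA3 i (Finset.mem_univ i)
    simp only [w, h, if_true] at h2
    rw [le_div_iff₀ h] at h2
    exact h2.trans (hmono i h1)
  · exact (mul_nonpos_of_nonneg_of_nonpos ht0 (not_lt.mp h)).trans
      ((hsub i).nonneg (hmono i) _)
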